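/- All graphs are finite and simple (no loops, no multiple edges). A cycle in a graph is a subgraph isomorphic to an $n$-gon with $n\ge 3$; it is chordless if it is an induced subgraph. An orientation of a graph chooses a direction for each edge; it is cyclic if every chordless cycle becomes a directed cycle. A graph is cyclically orientable if it has a cyclic orientation. Call two edges equivalent if they are equal or lie on a common cycle; the two-connected components of a graph are the connected induced subgraphs whose edge sets are the equivalence classes. A graph is two-connected if it is connected, has at least one edge, and all its edges are equivalent (so a single edge is two-connected and a single vertex is not). Let $G$ be a graph. (1) $G$ is cyclically orientable if and only if all of its two-connected components are. (2) Suppose that $G$ is two-connected. Then $G$ is cyclically orientable if and only if it is a cycle, or a single edge, or there are subgraphs $G'$ and $C$ of $G$ with $G=G'\cup C$ such that $G'$ is cyclically orientable, $C$ is a cycle, and $G'\cap C$ consists of exactly one edge and its two endpoints. (3) If $G=G'\cup C$ for any subgraphs $G'$ and $C$ such that $C$ is a cycle and $G'\cap C$ consists of exactly one edge and its two endpoints, then $G$ is cyclically orientable if and only if $G'$ is. -/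

import Mathlib

namespace CyclicOrientation

/-- An orientation of a graph: each edge gets exactly one of its two directions;
`arc u v` says that the edge `{u, v}` is directed from `u` to `v`. -/
structure GraphOrientation {V : Type*} (G : SimpleGraph V) where
  /-- the directed edges -/
  arc : V → V → Prop
  adj_of_arc : ∀ {u v : V}, arc u v → G.Adj u v
  arc_or_arc : ∀ {u v : V}, G.Adj u v → arc u v ∨ arc v u
  asymm : ∀ {u v : V}, arc u v → ¬ arc v u

/-- An orientation is cyclic if every chordless cycle `c` of the graph is cyclically oriented:
all edges of `c` point in the direction in which `c` traverses them, or all point the other way. -/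
def GraphOrientation.IsCyclic {V : Type*} {G : SimpleGraph V} (o : GraphOrientation G) : Prop :=
  ∀ (u : V) (c : G.Walk u u), c.IsCycle → c.IsChordless →
    (∀ d ∈ c.darts, o.arc d.fst d.snd) ∨ (∀ d ∈ c.darts, o.arc d.snd d.fst)

/-- A graph is cyclically orientable if it has a cyclic orientation. -/
def CyclicallyOrientable {V : Type*} (G : SimpleGraph V) : Prop :=
  ∃ o : GraphOrientation G, o.IsCyclic

/-- A subgraph which is a cycle (of length at least three, the graphs being simple). -/
def IsCycleSubgraph {V : Type*} {G : SimpleGraph V} (C : G.Subgraph) : Prop :=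
  ∃ (u : V) (c : G.Walk u u), c.IsCycle ∧ c.toSubgraph = C

/-- The relation on edges whose classes are the edge sets of the two-connected components:
two edges are related if they are equal or lie on a common cycle. -/
def EdgeRel {V : Type*} (G : SimpleGraph V) (e f : Sym2 V) : Prop :=
  e = f ∨ ∃ (u : V) (c : G.Walk u u), c.IsCycle ∧ e ∈ c.edges ∧ f ∈ c.edges

/-- A two-connected component: a connected induced subgraph whose edge set is a class
of `EdgeRel`. -/
def IsTwoConnectedComponent {V : Type*} (G : SimpleGraph V) (B : G.Subgraph) : Prop :=
  B.Connected ∧ B.IsInduced ∧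
    ∃ e ∈ G.edgeSet, B.edgeSet = {f | f ∈ G.edgeSet ∧ EdgeRel G e f}

/-- A graph is two-connected if it is connected, has an edge, and any two of its edges are
related, i.e. if the whole graph is a two-connected component of itself.
A single edge is two-connected; a single vertex is not. -/
def IsTwoConnected {V : Type*} (G : SimpleGraph V) : Prop :=
  G.Connected ∧ G.edgeSet.Nonempty ∧ ∀ e ∈ G.edgeSet, ∀ f ∈ G.edgeSet, EdgeRel G e f

/-- The graph is a cycle. -/
def IsCycleGraph {V : Type*} (G : SimpleGraph V) : Prop :=
  IsCycleSubgraph (⊤ : G.Subgraph)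

/-- The graph is a single edge. -/
def IsSingleEdge {V : Type*} (G : SimpleGraph V) : Prop :=
  ∃ (v w : V) (h : G.Adj v w), (⊤ : G.Subgraph) = G.subgraphOfAdj h

/-- `G = G' ∪ C`, where `C` is a cycle and the subgraphs `G'` and `C` meet along a single edge:
their intersection consists of one edge and its two endpoints. -/
def IsCycleGluing {V : Type*} (G : SimpleGraph V) (G' C : G.Subgraph) : Prop :=
  IsCycleSubgraph C ∧ G' ⊔ C = ⊤ ∧ ∃ (v w : V) (h : G.Adj v w), G' ⊓ C = G.subgraphOfAdj h

end CyclicOrientation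

namespace CyclicOrientation

open SimpleGraph

variable {V : Type*} {G : SimpleGraph V}

/-! For (3), `G'` is automatically induced, so a cyclic orientation of `G` restricts to it.
Conversely, a vertex of `C` outside `G'` has all its edges on `C`. A chordless cycle through such a
vertex must follow `C` to both ends of the shared edge and, having no chord, contains that edge too:
it is `C` itself. So it suffices to direct `C` in agreement with the shared edge
(`IsCyclicOn.cyclicallyOrientable`).

For (1), being equal or on a common cycle is an equivalence relation (`EdgeRel.trans`), and each
class spans an induced component. Every cycle lies in a single component, so the components can be
oriented independently.

The hard half of (2) is to find a gluing in a cyclically oriented two-connected graph that is not a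
single edge. Take a maximal proper vertex set `S` with at least two elements that stays linked when
one vertex is deleted, and a shortest ear `T` on it. Maximality makes `S` and `T` cover the graph;
minimality leaves each vertex of `S` at most one neighbour in `T`. A chordless path in `S` whose
ends, and no inner vertices, are attached to `T` closes up through `T` to a chordless cycle, so the
connecting edge at its start dictates its direction. This forces attached vertices to be pairwise
adjacent (`adj_of_return`), and adjacent attached vertices to have connecting edges of opposite
direction, so there are no three of them (`not_triangle_of_return`). Hence `T` is attached at the
two ends of one edge, and with that edge it forms the glued cycle. A cycle graph arises here as a
cycle glued to a single edge. -/

/-! ### Shortest walks and chordless paths -/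

/-- A walk that is shortest among the walks with the same ends inside its support is a path. -/
theorem isPath_of_forall_length_le {u v : V} (q : G.Walk u v)
    (h : ∀ q' : G.Walk u v, q'.support ⊆ q.support → q.length ≤ q'.length) : q.IsPath := by
  classical
  have := q.bypass_eq_self_of_length_le_length_bypass (h _ q.support_bypass_subset_support)
  rw [← this]
  exact q.bypass_isPath

/-- A walk that is shortest among the walks with the same ends inside its support is chordless. -/
theorem isChordless_of_forall_length_le {u v : V} (q : G.Walk u v)
    (h : ∀ q' : G.Walk u v, q'.support ⊆ q.support → q.length ≤ q'.length) :
    q.IsChordless := by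
  classical
  induction q with
  | nil =>
    rw [Walk.isChordless_iff_forall_mem_edges]
    intro a b ha hb hab
    simp only [Walk.support_nil, List.mem_singleton] at ha hb
    exact (hab.ne (ha.trans hb.symm)).elim
  | @cons u x v hux q ih =>
    have ih' := ih fun q' hq' => by
      have := h (Walk.cons hux q') (by
        simp only [Walk.support_cons]
        exact List.cons_subset_cons _ hq')
      simpa using this
    -- Any other neighbour of the start on `q` would give a shortcut.
    have key : ∀ b ∈ q.support, G.Adj u b → b = x := by
      intro b hb hub
      by_contra hbx
      have h1 := h (Walk.cons hub (q.dropUntil b hb)) (by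
        simp only [Walk.support_cons]
        exact List.cons_subset_cons _ (q.support_dropUntil_subset_support hb))
      have h2 := Walk.length_dropUntil_lt_length hb hbx
      simp only [Walk.length_cons] at h1
      omega
    rw [Walk.isChordless_iff_forall_mem_edges]
    intro a b ha hb hab
    simp only [Walk.support_cons, List.mem_cons, Walk.edges_cons] at ha hb ⊢
    rcases ha with rfl | ha
    · rcases hb with rfl | hb
      · exact (hab.ne rfl).elim
      · left; rw [key b hb hab]
    · rcases hb with rfl | hb
      · left; rw [key a ha hab.symm, Sym2.eq_swap]
      · exact .inr (ih'.mem_edges ha hb hab)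

/-- A walk inside `A` to a vertex with property `R` can be replaced by a chordless path inside `A`
whose only vertex with property `R` is its end. -/
theorem exists_chordless_path_to (A : Set V) (R : V → Prop) {u v : V} (w : G.Walk u v)
    (hA : ∀ z ∈ w.support, z ∈ A) (hR : R v) :
    ∃ (v' : V) (q : G.Walk u v'), q.IsPath ∧ q.IsChordless ∧ (∀ z ∈ q.support, z ∈ A) ∧
      R v' ∧ ∀ z ∈ q.support, R z → z = v' := by
  classical
  -- The length is minimised over all ends satisfying `R` at once, so that a prefix ending at an
  -- earlier `R`-vertex would be a shorter competitor.
  let L : Set ℕ := {n | ∃ (v' : V) (q : G.Walk u v'), (∀ z ∈ q.support, z ∈ A) ∧ R v' ∧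
    q.length = n}
  have hL : L.Nonempty := ⟨_, v, w, hA, hR, rfl⟩
  obtain ⟨v', q, hqA, hqR, hqn⟩ := Nat.sInf_mem hL
  have hmin : ∀ (x : V) (q' : G.Walk u x), (∀ z ∈ q'.support, z ∈ A) → R x →
      q.length ≤ q'.length := fun x q' h1 h2 => hqn ▸ Nat.sInf_le ⟨x, q', h1, h2, rfl⟩
  have hmin' : ∀ q' : G.Walk u v', q'.support ⊆ q.support → q.length ≤ q'.length :=
    fun q' hq' => hmin _ q' (fun z hz => hqA z (hq' hz)) hqR
  refine ⟨v', q, isPath_of_forall_length_le q hmin', isChordless_of_forall_length_le q hmin', hqA,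
    hqR, fun z hz hRz => ?_⟩
  by_contra hne
  have h1 := hmin z (q.takeUntil z hz)
    (fun y hy => hqA y (q.support_takeUntil_subset_support hz hy)) hRz
  have h2 := Walk.length_takeUntil_lt_length hz hne
  omega

theorem exists_chordless_path (A : Set V) {u v : V} (w : G.Walk u v)
    (hA : ∀ z ∈ w.support, z ∈ A) :
    ∃ q : G.Walk u v, q.IsPath ∧ q.IsChordless ∧ ∀ z ∈ q.support, z ∈ A := by
  obtain ⟨_, q, h1, h2, h3, rfl, -⟩ := exists_chordless_path_to A (· = v) w hA rfl
  exact ⟨q, h1, h2, h3⟩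

/-! ### Chordless cycles made of two paths -/

section Closing

variable {u v u' v' : V} {P : G.Walk u v} {Q : G.Walk v' u'}

/-- Two disjoint paths joined by two edges form a cycle. -/
theorem isCycle_cons_append_cons (hP : P.IsPath) (hQ : Q.IsPath)
    (hd : ∀ z ∈ P.support, z ∉ Q.support) (h : G.Adj v v') (h' : G.Adj u' u)
    (hne : u ≠ v ∨ u' ≠ v') : (Walk.cons h' (P.append (Walk.cons h Q))).IsCycle := by
  rw [Walk.cons_isCycle_iff]
  constructor
  · rw [Walk.isPath_def, Walk.support_append, Walk.support_cons, List.tail_cons,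
      List.nodup_append']
    exact ⟨hP.support_nodup, hQ.support_nodup, fun z h1 h2 => hd z h1 h2⟩
  · rw [Walk.edges_append, Walk.edges_cons]
    simp only [List.mem_append, List.mem_cons, not_or]
    refine ⟨fun hm => ?_, fun hm => ?_, fun hm => ?_⟩
    · exact hd _ (P.fst_mem_support_of_mem_edges hm) Q.end_mem_support
    · rw [Sym2.eq_iff] at hm
      rcases hm with ⟨rfl, rfl⟩ | ⟨rfl, rfl⟩
      · exact hd _ P.start_mem_support Q.start_mem_support
      -- The two joining edges coincide only if both paths are single vertices, which `hne`
      -- excludes.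
      · simp at hne
    · exact hd _ P.start_mem_support (Q.snd_mem_support_of_mem_edges hm)

theorem isChordless_cons_append_cons (cP : P.IsChordless) (cQ : Q.IsChordless)
    (h : G.Adj v v') (h' : G.Adj u' u)
    (hab : ∀ a ∈ P.support, ∀ b ∈ Q.support, G.Adj a b → (a = v ∧ b = v') ∨ (a = u ∧ b = u')) :
    (Walk.cons h' (P.append (Walk.cons h Q))).IsChordless := by
  have hs : ∀ z, z ∈ (Walk.cons h' (P.append (Walk.cons h Q))).support →
      z ∈ P.support ∨ z ∈ Q.support := by
    intro z
    simp only [Walk.support_cons, List.mem_cons, Walk.mem_support_append_iff]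
    rintro (rfl | hz | rfl | hz)
    · exact .inr Q.end_mem_support
    · exact .inl hz
    · exact .inl P.end_mem_support
    · exact .inr hz
  rw [Walk.isChordless_iff_forall_mem_edges]
  intro a b ha hb hadj
  rw [Walk.edges_cons, Walk.edges_append, Walk.edges_cons]
  simp only [List.mem_append, List.mem_cons]
  rcases hs a ha with ha | ha <;> rcases hs b hb with hb | hb
  · exact .inr (.inl (cP.mem_edges ha hb hadj))
  · rcases hab a ha b hb hadj with ⟨rfl, rfl⟩ | ⟨rfl, rfl⟩
    · exact .inr (.inr (.inl rfl))
    · exact .inl Sym2.eq_swap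
  · rcases hab b hb a ha hadj.symm with ⟨rfl, rfl⟩ | ⟨rfl, rfl⟩
    · exact .inr (.inr (.inl Sym2.eq_swap))
    · exact .inl rfl
  · exact .inr (.inr (.inr (cQ.mem_edges ha hb hadj)))

/-- In a cyclic orientation, a chordless cycle made of two disjoint paths and two joining edges
is directed. -/
theorem GraphOrientation.IsCyclic.arc_or_arc_of_paths {o : GraphOrientation G} (ho : o.IsCyclic)
    (hP : P.IsPath) (hQ : Q.IsPath) (cP : P.IsChordless) (cQ : Q.IsChordless)
    (hd : ∀ z ∈ P.support, z ∉ Q.support) (h : G.Adj v v') (h' : G.Adj u' u)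
    (hne : u ≠ v ∨ u' ≠ v')
    (hab : ∀ a ∈ P.support, ∀ b ∈ Q.support, G.Adj a b → (a = v ∧ b = v') ∨ (a = u ∧ b = u')) :
    (o.arc u' u ∧ o.arc v v' ∧ ∀ d ∈ P.darts, o.arc d.fst d.snd) ∨
      (o.arc u u' ∧ o.arc v' v ∧ ∀ d ∈ P.darts, o.arc d.snd d.fst) := by
  have := ho _ _ (isCycle_cons_append_cons hP hQ hd h h' hne)
    (isChordless_cons_append_cons cP cQ h h' hab)
  simp only [Walk.darts_cons, Walk.darts_append, List.mem_cons, List.mem_append] at this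
  rcases this with H | H
  · exact .inl ⟨H ⟨(u', u), h'⟩ (.inl rfl), H ⟨(v, v'), h⟩ (.inr (.inr (.inl rfl))),
      fun d hd => H d (.inr (.inl hd))⟩
  · exact .inr ⟨H ⟨(u', u), h'⟩ (.inl rfl), H ⟨(v, v'), h⟩ (.inr (.inr (.inl rfl))),
      fun d hd => H d (.inr (.inl hd))⟩

end Closing

/-! ### Attachments of a linked set in a cyclic orientation -/

/-- Any two vertices of `A` are joined by a walk inside `A`. -/
def LinkedIn (G : SimpleGraph V) (A : Set V) : Prop :=
  ∀ x ∈ A, ∀ y ∈ A, ∃ w : G.Walk x y, ∀ z ∈ w.support, z ∈ A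

theorem isChordless_cons {u v w : V} {q : G.Walk v w} (hq : q.IsChordless) (h : G.Adj u v)
    (hu : ∀ z ∈ q.support, G.Adj u z → z = v) : (Walk.cons h q).IsChordless := by
  rw [Walk.isChordless_iff_forall_mem_edges]
  intro a b ha hb hab
  simp only [Walk.support_cons, List.mem_cons, Walk.edges_cons] at ha hb ⊢
  rcases ha with rfl | ha
  · rcases hb with rfl | hb
    · exact (hab.ne rfl).elim
    · left; rw [hu b hb hab]
  · rcases hb with rfl | hb
    · left; rw [hu a ha hab.symm, Sym2.eq_swap]
    · exact .inr (hq.mem_edges ha hb hab)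

section Separation

variable {o : GraphOrientation G} {S T : Set V}

/-- If a vertex set `T` avoiding `S` is linked and every vertex of `S` has at most one neighbour
in `T`, then a chordless path in `S` whose ends, but no inner vertices, have neighbours in `T` is
directed, in a direction determined by the edge joining its start to `T`. -/
theorem GraphOrientation.IsCyclic.directed_of_return (ho : o.IsCyclic)
    (hST : ∀ z ∈ S, z ∉ T) (hT : LinkedIn G T)
    (hu : ∀ z ∈ S, ∀ t ∈ T, ∀ t' ∈ T, G.Adj z t → G.Adj z t' → t = t')
    {x y tx ty : V} (hxy : x ≠ y) (htx : tx ∈ T) (hty : ty ∈ T)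
    (hxt : G.Adj x tx) (hyt : G.Adj y ty) (w : G.Walk x y) (hw : w.IsPath) (cw : w.IsChordless)
    (hwS : ∀ z ∈ w.support, z ∈ S)
    (hwT : ∀ z ∈ w.support, (∃ t ∈ T, G.Adj z t) → z = x ∨ z = y) :
    (o.arc tx x → ∀ d ∈ w.darts, o.arc d.fst d.snd) ∧
      (o.arc x tx → ∀ d ∈ w.darts, o.arc d.snd d.fst) := by
  obtain ⟨q, hq⟩ := hT ty hty tx htx
  obtain ⟨q, q1, q2, q3⟩ := exists_chordless_path T q hq
  -- `hwT` and `hu` leave only the two closing edges between `w` and the return path `q`, so the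
  -- cycle is chordless.
  have := ho.arc_or_arc_of_paths hw q1 cw q2 (fun z h1 h2 => hST z (hwS z h1) (q3 z h2)) hyt
    hxt.symm (.inl hxy) (fun a ha b hb hab => by
      rcases hwT a ha ⟨b, q3 b hb, hab⟩ with rfl | rfl
      · exact .inr ⟨rfl, hu a (hwS a ha) b (q3 b hb) tx htx hab hxt⟩
      · exact .inl ⟨rfl, hu a (hwS a ha) b (q3 b hb) ty hty hab hyt⟩)
  rcases this with ⟨h1, -, h2⟩ | ⟨h1, -, h2⟩
  · exact ⟨fun _ => h2, fun h => (o.asymm h h1).elim⟩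
  · exact ⟨fun h => (o.asymm h h1).elim, fun _ => h2⟩

theorem GraphOrientation.IsCyclic.arc_of_adj_of_return (ho : o.IsCyclic)
    (hST : ∀ z ∈ S, z ∉ T) (hT : LinkedIn G T)
    (hu : ∀ z ∈ S, ∀ t ∈ T, ∀ t' ∈ T, G.Adj z t → G.Adj z t' → t = t')
    {x y tx ty : V} (hx : x ∈ S) (hy : y ∈ S) (htx : tx ∈ T) (hty : ty ∈ T)
    (hxt : G.Adj x tx) (hyt : G.Adj y ty) (hxy : G.Adj x y) :
    (o.arc tx x → o.arc x y) ∧ (o.arc x tx → o.arc y x) := by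
  have := ho.directed_of_return hST hT hu hxy.ne htx hty hxt hyt hxy.toWalk hxy.isPath_toWalk
    hxy.isChordless_toWalk (by
      intro z hz
      rw [hxy.support_toWalk] at hz
      simp only [List.mem_cons, List.not_mem_nil, or_false] at hz
      rcases hz with rfl | rfl <;> assumption) (by
      intro z hz _
      rw [hxy.support_toWalk] at hz
      simpa using hz)
  have hd : (⟨(x, y), hxy⟩ : G.Dart) ∈ hxy.toWalk.darts := by simp [SimpleGraph.Adj.toWalk]
  exact ⟨fun h => this.1 h _ hd, fun h => this.2 h _ hd⟩

/-- No three pairwise adjacent vertices of `S` have neighbours in `T`. -/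
theorem GraphOrientation.IsCyclic.not_triangle_of_return (ho : o.IsCyclic)
    (hST : ∀ z ∈ S, z ∉ T) (hT : LinkedIn G T)
    (hu : ∀ z ∈ S, ∀ t ∈ T, ∀ t' ∈ T, G.Adj z t → G.Adj z t' → t = t')
    {x y z tx ty tz : V} (hx : x ∈ S) (hy : y ∈ S) (hz : z ∈ S) (htx : tx ∈ T) (hty : ty ∈ T)
    (htz : tz ∈ T) (hxt : G.Adj x tx) (hyt : G.Adj y ty) (hzt : G.Adj z tz)
    (hxy : G.Adj x y) (hyz : G.Adj y z) (hxz : G.Adj x z) : False := by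
  -- Across an edge of attached vertices the connecting edges have opposite directions; such a
  -- two-colouring is impossible on a triangle.
  have key : ∀ {x y tx ty : V}, x ∈ S → y ∈ S → tx ∈ T → ty ∈ T → G.Adj x tx → G.Adj y ty →
      G.Adj x y → (o.arc tx x ↔ ¬ o.arc ty y) := by
    intro x y tx ty hx hy htx hty hxt hyt hxy
    have e1 := ho.arc_of_adj_of_return hST hT hu hx hy htx hty hxt hyt hxy
    have e2 := ho.arc_of_adj_of_return hST hT hu hy hx hty htx hyt hxt hxy.symm
    constructor
    · exact fun h h' => o.asymm (e1.1 h) (e2.1 h')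
    · intro h
      by_contra h'
      exact o.asymm (e1.2 ((o.arc_or_arc hxt).resolve_right h'))
        (e2.2 ((o.arc_or_arc hyt).resolve_right h))
  have k1 := key hx hy htx hty hxt hyt hxy
  have k2 := key hy hz hty htz hyt hzt hyz
  have k3 := key hx hz htx htz hxt hzt hxz
  tauto

/-- A walk from a component `K` of the set of vertices that are neither `x` nor neighbours of `x`
to `x` goes through a neighbour of `x` that is adjacent to `K`. -/
theorem exists_adj_of_walk {K : Set V} {x k : V} {B : Set V}
    (hK : ∀ k ∈ K, k ≠ x ∧ ¬ G.Adj x k)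
    (hcl : ∀ k ∈ K, ∀ z ∈ B, G.Adj k z → z ≠ x → ¬ G.Adj x z → z ∈ K)
    (w : G.Walk k x) (hk : k ∈ K) (hw : ∀ z ∈ w.support, z ∈ B) :
    ∃ a ∈ B, G.Adj x a ∧ ∃ k ∈ K, G.Adj a k := by
  induction w with
  | nil => exact ((hK _ hk).1 rfl).elim
  | @cons k z x hkz w ih =>
    have hzB : z ∈ B := hw z (by simp)
    by_cases hzx : z = x
    · subst hzx
      exact ((hK _ hk).2 hkz.symm).elim
    by_cases hxz : G.Adj x z
    · exact ⟨z, hzB, hxz, k, hk, hkz.symm⟩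
    · exact ih hK hcl (hcl k hk z hzB hkz hzx hxz) fun y hy => hw y (by simp [hy])

/-- Suppose `x` and `y` are not adjacent, and let `K` be the component of `y` in `S` without `x` and
its neighbours. For a neighbour `a` of `x` adjacent to `K`, a path from `x` through `a` and on
inside `K` returns to `T`, so the direction of `xa` is dictated by that of the edge between `x` and
`tx`. Deleting a vertex leaves `S` linked, which gives two such neighbours. They lie with `x` on a
chordless cycle through `K`, where one edge at `x` must enter and the other leave: a contradiction.
-/
theorem GraphOrientation.IsCyclic.adj_of_return (ho : o.IsCyclic)
    (hS : ∀ a, LinkedIn G (S \ {a}))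
    (hST : ∀ z ∈ S, z ∉ T) (hT : LinkedIn G T)
    (hu : ∀ z ∈ S, ∀ t ∈ T, ∀ t' ∈ T, G.Adj z t → G.Adj z t' → t = t')
    {x y tx ty : V} (hx : x ∈ S) (hy : y ∈ S) (hxy : x ≠ y) (htx : tx ∈ T) (hty : ty ∈ T)
    (hxt : G.Adj x tx) (hyt : G.Adj y ty) : G.Adj x y := by
  classical
  by_contra hnadj
  let Z : Set V := {z | z ∈ S ∧ z ≠ x ∧ ¬ G.Adj x z}
  let K : Set V := {k | ∃ w : G.Walk y k, ∀ z ∈ w.support, z ∈ Z}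
  have hKZ : ∀ k ∈ K, k ∈ Z := fun k ⟨w, hw⟩ => hw k w.end_mem_support
  have hyK : y ∈ K := ⟨Walk.nil, by
    intro z hz
    rw [Walk.support_nil, List.mem_singleton] at hz
    subst hz
    exact ⟨hy, hxy.symm, hnadj⟩⟩
  have hlink : ∀ k ∈ K, ∃ w : G.Walk y k, ∀ z ∈ w.support, z ∈ K := by
    rintro k ⟨w, hw⟩
    exact ⟨w, fun z hz => ⟨w.takeUntil z hz,
      fun y hy => hw y (w.support_takeUntil_subset_support hz hy)⟩⟩
  have hcl : ∀ k ∈ K, ∀ z ∈ S, G.Adj k z → z ≠ x → ¬ G.Adj x z → z ∈ K := by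
    rintro k ⟨w, hw⟩ z hz hkz hzx hxz
    refine ⟨w.concat hkz, fun y hy => ?_⟩
    rw [Walk.support_concat] at hy
    simp only [List.mem_append, List.mem_singleton] at hy
    rcases hy with hy | rfl
    · exact hw y hy
    · exact ⟨hz, hzx, hxz⟩
  have hA : ∀ b, b ≠ x → b ≠ y → ∃ a ∈ S \ {b}, G.Adj x a ∧ ∃ k ∈ K, G.Adj a k := by
    intro b hbx hby
    obtain ⟨w, hw⟩ := hS b y ⟨hy, hby.symm⟩ x ⟨hx, hbx.symm⟩
    exact exists_adj_of_walk (fun k hk => (hKZ k hk).2)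
      (fun k hk z hz => hcl k hk z hz.1) w hyK hw
  have harc : ∀ a ∈ S, G.Adj x a → (∃ k ∈ K, G.Adj a k) →
      (o.arc tx x → o.arc x a) ∧ (o.arc x tx → o.arc a x) := by
    rintro a haS hxa ⟨k, hk, hak⟩
    obtain ⟨w, hw⟩ := hlink k hk
    obtain ⟨v, q, q1, q2, q3, ⟨t, ht, hvt⟩, q4⟩ := exists_chordless_path_to (insert a K)
      (fun z => ∃ t ∈ T, G.Adj z t) (Walk.cons hak w.reverse) (by
        intro z hz
        simp only [Walk.support_cons, List.mem_cons, Walk.support_reverse, List.mem_reverse] at hz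
        rcases hz with rfl | hz
        · exact .inl rfl
        · exact .inr (hw z hz)) ⟨ty, hty, hyt⟩
    have hxq : x ∉ q.support := fun h => by
      rcases q3 x h with rfl | h
      · exact hxa.ne rfl
      · exact (hKZ x h).2.1 rfl
    have := ho.directed_of_return hST hT hu (x := x) (y := v)
      (fun h => hxq (h ▸ q.end_mem_support)) htx ht hxt hvt (Walk.cons hxa q) (q1.cons hxq)
      (isChordless_cons q2 hxa fun z hz hxz => by
        rcases q3 z hz with rfl | h
        · rfl
        · exact ((hKZ z h).2.2 hxz).elim) (by
        intro z hz
        simp only [Walk.support_cons, List.mem_cons] at hz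
        rcases hz with rfl | hz
        · exact hx
        · rcases q3 z hz with rfl | h
          · exact haS
          · exact (hKZ z h).1) (by
        intro z hz hzt
        simp only [Walk.support_cons, List.mem_cons] at hz
        rcases hz with rfl | hz
        · exact .inl rfl
        · exact .inr (q4 z hz hzt))
    have hd : (⟨(x, a), hxa⟩ : G.Dart) ∈ (Walk.cons hxa q).darts := by simp
    exact ⟨fun h => this.1 h _ hd, fun h => this.2 h _ hd⟩
  -- Nothing need be deleted to find the first neighbour; `tx`, being outside `S`, is a harmless
  -- choice.
  obtain ⟨a, ⟨haS, -⟩, hxa, ka, hka, haka⟩ := hA tx hxt.ne' fun h => hST y hy (h ▸ htx)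
  obtain ⟨b, ⟨hbS, hba⟩, hxb, kb, hkb, hbkb⟩ := hA a hxa.ne' fun h => hnadj (h ▸ hxa)
  obtain ⟨wa, hwa⟩ := hlink ka hka
  obtain ⟨wb, hwb⟩ := hlink kb hkb
  obtain ⟨q, q1, q2, q3⟩ := exists_chordless_path (insert a (insert b K))
    (Walk.cons haka ((wa.reverse.append wb).concat hbkb.symm)) (by
      intro z hz
      simp only [Walk.support_cons, List.mem_cons, Walk.support_concat,
        Walk.mem_support_append_iff, Walk.support_reverse, List.mem_reverse, List.mem_append,
        List.not_mem_nil, or_false] at hz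
      rcases hz with rfl | (hz | hz) | rfl
      · exact .inl rfl
      · exact .inr (.inr (hwa z hz))
      · exact .inr (.inr (hwb z hz))
      · exact .inr (.inl rfl))
  have := ho.arc_or_arc_of_paths (P := (Walk.nil : G.Walk x x)) (Q := q) Walk.IsPath.nil q1
    (Walk.isChordless_iff_forall_mem_edges.2 (by
      intro c d hc hd hcd
      simp only [Walk.support_nil, List.mem_singleton] at hc hd
      exact (hcd.ne (hc.trans hd.symm)).elim)) q2 (by
      intro z hz hzq
      simp only [Walk.support_nil, List.mem_singleton] at hz
      subst hz
      rcases q3 z hzq with h | h | h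
      · exact hxa.ne h
      · exact hxb.ne h
      · exact (hKZ z h).2.1 rfl) hxa hxb.symm (.inr hba) (by
      intro c hc d hd hcd
      simp only [Walk.support_nil, List.mem_singleton] at hc
      subst hc
      rcases q3 d hd with h | h | h
      · exact .inl ⟨rfl, h⟩
      · exact .inr ⟨rfl, h⟩
      · exact ((hKZ d h).2.2 hcd).elim)
  have ea := harc a haS hxa ⟨ka, hka, haka⟩
  have eb := harc b hbS hxb ⟨kb, hkb, hbkb⟩
  have a1 := @o.asymm x a
  have a2 := @o.asymm x b
  rcases o.arc_or_arc hxt with h1 | h1 <;> tauto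

end Separation

/-! ### Two-linked vertex sets -/

/-- The set `S` stays linked after the removal of at most one vertex. -/
def TwoLinked (G : SimpleGraph V) (S : Set V) : Prop :=
  ∀ B : Set V, B.Subsingleton → LinkedIn G (S \ B)

/-- Two neighbours of `a` on a common cycle through `a` are joined by a walk avoiding `a`. -/
theorem exists_walk_avoiding_of_edgeRel {a b e : V} (h : EdgeRel G s(a, b) s(a, e)) :
    ∃ w : G.Walk b e, b ≠ a → a ∉ w.support := by
  classical
  rcases h with h | ⟨u, c, hc, hb, he⟩
  · have : b = e := Sym2.congr_right.1 h
    subst this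
    exact ⟨Walk.nil, fun hba => by simpa using hba.symm⟩
  · have ha : a ∈ c.support := c.fst_mem_support_of_mem_edges hb
    have hc' : (c.rotate a ha).IsCycle := by simpa using hc
    have hb' : s(a, b) ∈ (c.rotate a ha).edges := (c.rotate_edges a ha).mem_iff.2 hb
    have he' : s(a, e) ∈ (c.rotate a ha).edges := (c.rotate_edges a ha).mem_iff.2 he
    generalize c.rotate a ha = c' at hc' hb' he'
    cases c' with
    | nil => simp at hb'
    | @cons _ x _ hax p =>
      have hp := ((Walk.cons_isCycle_iff p hax).1 hc').1
      rw [Walk.edges_cons, List.mem_cons, ← List.mem_reverse, ← Walk.edges_reverse] at hb' he'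
      have hr := hp.reverse
      -- The cycle now starts at `a`. Peeling off its first edge and, after reversal, its last one
      -- leaves a path `r` off `a` between the two cycle neighbours of `a`.
      generalize p.reverse = r at hr hb' he'
      cases r with
      | nil => exact (hax.ne rfl).elim
      | @cons _ y _ hay r =>
        have har : a ∉ r.support := ((Walk.cons_isPath_iff hay r).1 hr).2
        have key : ∀ z, s(a, z) = s(a, x) ∨ s(a, z) ∈ (Walk.cons hay r).edges → z = x ∨ z = y := by
          intro z hz
          simp only [Walk.edges_cons, List.mem_cons] at hz
          rcases hz with hz | hz | hz
          · exact .inl (Sym2.congr_right.1 hz)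
          · exact .inr (Sym2.congr_right.1 hz)
          · exact (har (r.fst_mem_support_of_mem_edges hz)).elim
        rcases key b hb' with rfl | rfl <;> rcases key e he' with rfl | rfl
        · exact ⟨Walk.nil, fun h => by simpa using h.symm⟩
        · exact ⟨r.reverse, fun _ => by simpa using har⟩
        · exact ⟨r, fun _ => har⟩
        · exact ⟨Walk.nil, fun h => by simpa using h.symm⟩

/-- A passage of the walk through `a` is replaced by a detour between two neighbours of `a`. The
second conjunct carries the induction through `a`: there the walk restarts from whichever neighbour
it came from. -/
theorem exists_walk_avoiding {a u w : V}
    (h : ∀ b e, G.Adj a b → G.Adj a e → EdgeRel G s(a, b) s(a, e)) (p : G.Walk u w) (hw : w ≠ a) :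
    (u ≠ a → ∃ q : G.Walk u w, a ∉ q.support) ∧
      (u = a → ∀ b, G.Adj a b → ∃ q : G.Walk b w, a ∉ q.support) := by
  induction p with
  | nil => exact ⟨fun _ => ⟨Walk.nil, by simpa using hw.symm⟩, fun h => (hw h).elim⟩
  | @cons u z w huz p ih =>
    have ih := ih hw
    constructor
    · intro hu
      by_cases hz : z = a
      · subst hz
        exact ih.2 rfl u huz.symm
      · obtain ⟨q, hq⟩ := ih.1 hz
        exact ⟨Walk.cons huz q, by simp [hq, hu.symm]⟩
    · rintro rfl b hub
      obtain ⟨q, hq⟩ := ih.1 huz.ne'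
      obtain ⟨r, hr⟩ := exists_walk_avoiding_of_edgeRel (h b z hub huz)
      exact ⟨r.append q, by simp [hq, hr hub.ne']⟩

theorem IsTwoConnected.twoLinked (h : IsTwoConnected G) : TwoLinked G Set.univ := by
  intro B hB x hx y hy
  obtain ⟨w⟩ := h.1.preconnected x y
  by_cases hB' : B = ∅
  · subst hB'
    exact ⟨w, by simp⟩
  · obtain ⟨a, ha⟩ := Set.nonempty_iff_ne_empty.2 hB'
    have hBa : B = {a} := hB.eq_singleton_of_mem ha
    subst hBa
    obtain ⟨q, hq⟩ := (exists_walk_avoiding (fun b e hb he => h.2.2 _ hb _ he) w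
      (by simpa using hy)).1 (by simpa using hx)
    exact ⟨q, fun z hz => ⟨trivial, fun hza => hq (hza ▸ hz)⟩⟩

theorem twoLinked_pair {u v : V} (h : G.Adj u v) : TwoLinked G {u, v} := by
  rintro B - x ⟨hx, hxB⟩ y ⟨hy, hyB⟩
  by_cases hxy : x = y
  · subst hxy
    exact ⟨Walk.nil, by
      intro z hz
      rw [Walk.support_nil, List.mem_singleton] at hz
      exact hz ▸ ⟨hx, hxB⟩⟩
  · have hadj : G.Adj x y := by
      rcases hx with rfl | rfl <;> rcases hy with rfl | rfl
      · exact (hxy rfl).elim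
      · exact h
      · exact h.symm
      · exact (hxy rfl).elim
    refine ⟨hadj.toWalk, ?_⟩
    intro z hz
    rw [hadj.support_toWalk] at hz
    simp only [List.mem_cons, List.not_mem_nil, or_false] at hz
    rcases hz with rfl | rfl
    · exact ⟨hx, hxB⟩
    · exact ⟨hy, hyB⟩

/-- Adding a path with ends in `S` keeps `S` linked after the removal of any vertex. -/
theorem TwoLinked.union_support {S : Set V} (hS : TwoLinked G S) {x y : V} (hx : x ∈ S)
    (hy : y ∈ S) (w : G.Walk x y) (hw : w.IsPath) : TwoLinked G (S ∪ {z | z ∈ w.support}) := by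
  classical
  intro B hB
  have key : ∀ c ∈ (S ∪ {z | z ∈ w.support}) \ B, ∃ s ∈ S \ B, ∃ q : G.Walk c s,
      ∀ z ∈ q.support, z ∈ (S ∪ {z | z ∈ w.support}) \ B := by
    rintro c ⟨hc | hc, hcB⟩
    · exact ⟨c, ⟨hc, hcB⟩, Walk.nil, by
        intro z hz
        rw [Walk.support_nil, List.mem_singleton] at hz
        exact hz ▸ ⟨.inl hc, hcB⟩⟩
    · have hc : c ∈ w.support := hc
      by_cases h1 : ∀ z ∈ (w.takeUntil c hc).support, z ∉ B
      · refine ⟨x, ⟨hx, h1 x (Walk.start_mem_support _)⟩, (w.takeUntil c hc).reverse, ?_⟩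
        intro z hz
        rw [Walk.support_reverse, List.mem_reverse] at hz
        exact ⟨.inr (w.support_takeUntil_subset_support hc hz), h1 z hz⟩
      · refine ⟨y, ?_, w.dropUntil c hc, ?_⟩
        all_goals
          push Not at h1
          obtain ⟨a, ha, haB⟩ := h1
          have h2 : ∀ z ∈ (w.dropUntil c hc).support, z ∉ B := by
            intro z hz hzB
            have hza := hB hzB haB
            subst hza
            have hp := hw
            rw [← w.take_spec hc] at hp
            by_cases hzc : z = c
            · exact hcB (hzc ▸ hzB)
            · exact hp.ne_of_mem_support_of_append hzc ha hz rfl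
        · exact ⟨hy, h2 y (Walk.end_mem_support _)⟩
        · exact fun z hz => ⟨.inr (w.support_dropUntil_subset_support hc hz), h2 z hz⟩
  intro c hc d hd
  obtain ⟨s, hs, q, hq⟩ := key c hc
  obtain ⟨t, ht, r, hr⟩ := key d hd
  obtain ⟨m, hm⟩ := hS B hB s hs t ht
  refine ⟨q.append (m.append r.reverse), ?_⟩
  intro z hz
  simp only [Walk.mem_support_append_iff, Walk.support_reverse, List.mem_reverse] at hz
  rcases hz with hz | hz | hz
  · exact hq z hz
  · exact ⟨.inl (hm z hz).1, (hm z hz).2⟩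
  · exact hr z hz

/-! ### Shortest ears and the glued cycle -/

theorem exists_walk_to_boundary {S : Set V} {w s : V} (p : G.Walk w s) (hw : w ∉ S) (hs : s ∈ S) :
    ∃ (p' y : V) (q : G.Walk w p'), (∀ z ∈ q.support, z ∉ S) ∧ G.Adj p' y ∧ y ∈ S ∧
      y ∈ p.support := by
  induction p with
  | nil => exact (hw hs).elim
  | @cons w z s hwz p ih =>
    by_cases hz : z ∈ S
    · exact ⟨w, z, Walk.nil, by simpa using hw, hwz, hz, by simp⟩
    · obtain ⟨p', y, q, h1, h2, h3, h4⟩ := ih hz hs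
      exact ⟨p', y, Walk.cons hwz q, by simpa [hw] using h1, h2, h3, by simp [h4]⟩

/-- A walk outside `S` whose ends are adjacent to different vertices of `S`. -/
def IsEarOf (S : Set V) {p p' : V} (x y : V) (q : G.Walk p p') : Prop :=
  x ∈ S ∧ y ∈ S ∧ x ≠ y ∧ G.Adj x p ∧ G.Adj p' y ∧ ∀ z ∈ q.support, z ∉ S

/-- From a vertex outside `S`, one walk first hits `S` at some `x`; a second one, avoiding `x`,
first hits it elsewhere. -/
theorem exists_ear {S : Set V} (h : TwoLinked G Set.univ) (hS : S.Nontrivial) (hne : S ≠ Set.univ) :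
    ∃ (x y p p' : V) (q : G.Walk p p'), IsEarOf S x y q := by
  obtain ⟨w, hw⟩ := (Set.ne_univ_iff_exists_notMem S).1 hne
  obtain ⟨s, hs⟩ := hS.nonempty
  obtain ⟨r, -⟩ := h ∅ Set.subsingleton_empty w ⟨trivial, id⟩ s ⟨trivial, id⟩
  obtain ⟨p, x, q1, h1, h2, hx, -⟩ := exists_walk_to_boundary r hw hs
  obtain ⟨s', hs', hne⟩ := hS.exists_ne x
  obtain ⟨r', hr'⟩ := h {x} Set.subsingleton_singleton w
    ⟨trivial, fun h => hw (by rw [Set.mem_singleton_iff] at h; exact h ▸ hx)⟩ s' ⟨trivial, hne⟩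
  obtain ⟨p', y, q2, h3, h4, hy, hyr⟩ := exists_walk_to_boundary r' hw hs'
  refine ⟨x, y, p, p', q1.reverse.append q2, hx, hy, fun h => (hr' y hyr).2 h.symm, h2.symm, h4, ?_⟩
  intro z hz
  simp only [Walk.mem_support_append_iff, Walk.support_reverse, List.mem_reverse] at hz
  exact hz.elim (h1 z) (h3 z)

theorem exists_minimal_ear {S : Set V} (h : TwoLinked G Set.univ) (hS : S.Nontrivial)
    (hne : S ≠ Set.univ) :
    ∃ (x y p p' : V) (q : G.Walk p p'), IsEarOf S x y q ∧
      ∀ (x₁ y₁ p₁ p₁' : V) (q₁ : G.Walk p₁ p₁'), IsEarOf S x₁ y₁ q₁ → q.length ≤ q₁.length := by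
  obtain ⟨x, y, p, p', q, hq⟩ := exists_ear h hS hne
  let L : Set ℕ := {n | ∃ (x y p p' : V) (q : G.Walk p p'), IsEarOf S x y q ∧ q.length = n}
  obtain ⟨x, y, p, p', q, hq, hn⟩ := Nat.sInf_mem (s := L) ⟨_, x, y, p, p', q, hq, rfl⟩
  exact ⟨x, y, p, p', q, hq, fun x₁ y₁ p₁ p₁' q₁ hq₁ =>
    hn ▸ Nat.sInf_le ⟨x₁, y₁, p₁, p₁', q₁, hq₁, rfl⟩⟩

theorem linkedIn_support {p p' : V} (q : G.Walk p p') : LinkedIn G {z | z ∈ q.support} := by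
  classical
  intro a ha b hb
  have ha : a ∈ q.support := ha
  have hb : b ∈ q.support := hb
  refine ⟨(q.takeUntil a ha).reverse.append (q.takeUntil b hb), fun z hz => ?_⟩
  simp only [Walk.mem_support_append_iff, Walk.support_reverse, List.mem_reverse] at hz
  exact hz.elim (fun h => q.support_takeUntil_subset_support ha h)
    (fun h => q.support_takeUntil_subset_support hb h)

/-- A graph is glued from an induced subgraph and a cycle consisting of an edge `xy` of the
subgraph and a chordless path, if the subgraph and the path cover the vertices and the edges
between them start at `x` or `y` and lead to the respective end of the path. -/
theorem isCycleGluing_of_ear {S : Set V} {x y p p' : V} (q : G.Walk p p') (hq : IsEarOf S x y q)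
    (hp : q.IsPath) (cq : q.IsChordless) (hxy : G.Adj x y)
    (huniv : ∀ z, z ∈ S ∨ z ∈ q.support)
    (hST : ∀ z ∈ S, ∀ t ∈ q.support, G.Adj z t → (z = x ∧ t = p) ∨ (z = y ∧ t = p')) :
    ∃ C : G.Subgraph, IsCycleGluing G ((⊤ : G.Subgraph).induce S) C := by
  obtain ⟨hx, hy, hne, hxp, hpy, hqS⟩ := hq
  -- The cycle runs from `p'` to `y`, `x`, `p` and back along `q`.
  let c := Walk.cons hpy (hxy.symm.toWalk.append (Walk.cons hxp q))
  have hsupp : ∀ z, z ∈ c.support ↔ z = x ∨ z = y ∨ z ∈ q.support := by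
    intro z
    have := q.end_mem_support
    simp only [c, Walk.support_cons, List.mem_cons, Walk.mem_support_append_iff,
      Walk.support_nil, List.not_mem_nil, or_false]
    constructor
    · rintro (rfl | (rfl | rfl) | rfl | h) <;> tauto
    · tauto
  have hedge : ∀ a b, s(a, b) ∈ c.edges ↔ s(a, b) = s(p', y) ∨ s(a, b) = s(y, x) ∨
      s(a, b) = s(x, p) ∨ s(a, b) ∈ q.edges := by
    intro a b
    simp only [c, Walk.edges_cons, List.mem_cons, Walk.edges_append,
      Walk.edges_nil, List.mem_append, List.not_mem_nil, or_false]
  have hc : c.IsCycle := isCycle_cons_append_cons hxy.symm.isPath_toWalk hp (by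
    intro z hz hzq
    rw [hxy.symm.support_toWalk] at hz
    simp only [List.mem_cons, List.not_mem_nil, or_false] at hz
    rcases hz with rfl | rfl
    · exact hqS _ hzq hy
    · exact hqS _ hzq hx) hxp hpy (.inl hne.symm)
  have hcov : ∀ a ∈ S, ∀ b ∈ q.support, G.Adj a b → s(a, b) ∈ c.edges := by
    intro a ha b hb hab
    rcases hST a ha b hb hab with ⟨rfl, rfl⟩ | ⟨rfl, rfl⟩
    · exact (hedge _ _).2 (.inr (.inr (.inl rfl)))
    · exact (hedge _ _).2 (.inl Sym2.eq_swap)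
  refine ⟨c.toSubgraph, ⟨p', c, hc, rfl⟩, ?_, x, y, hxy, ?_⟩
  · ext a b
    · simp only [Subgraph.verts_sup, Subgraph.induce_verts, Set.mem_union,
        Walk.mem_verts_toSubgraph, hsupp, Subgraph.verts_top, Set.mem_univ, iff_true]
      rcases huniv a with h | h <;> tauto
    · simp only [Subgraph.sup_adj, Subgraph.induce_adj, Subgraph.top_adj,
        Walk.adj_toSubgraph_iff_mem_edges]
      constructor
      · rintro (h | h)
        · exact h.2.2
        · exact c.adj_of_mem_edges h
      · intro hab
        rcases huniv a with ha | ha <;> rcases huniv b with hb | hb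
        · exact .inl ⟨ha, hb, hab⟩
        · exact .inr (hcov a ha b hb hab)
        · exact .inr (Sym2.eq_swap ▸ hcov b hb a ha hab.symm)
        · exact .inr ((hedge _ _).2 (.inr (.inr (.inr (cq.mem_edges ha hb hab)))))
  · ext a b
    · simp only [Subgraph.verts_inf, Subgraph.induce_verts, Set.mem_inter_iff,
        Walk.mem_verts_toSubgraph, hsupp, subgraphOfAdj_verts, Set.mem_insert_iff,
        Set.mem_singleton_iff]
      constructor
      · rintro ⟨h1, h2 | h2 | h2⟩
        · exact .inl h2
        · exact .inr h2
        · exact (hqS a h2 h1).elim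
      · rintro (rfl | rfl)
        · exact ⟨hx, .inl rfl⟩
        · exact ⟨hy, .inr (.inl rfl)⟩
    · simp only [Subgraph.inf_adj, Subgraph.induce_adj, Subgraph.top_adj,
        Walk.adj_toSubgraph_iff_mem_edges, hedge, subgraphOfAdj_adj]
      constructor
      · rintro ⟨⟨ha, hb, hab⟩, h | h | h | h⟩
        · have : p' ∈ s(a, b) := h ▸ Sym2.mem_mk_left _ _
          rcases Sym2.mem_iff.1 this with rfl | rfl
          · exact (hqS _ q.end_mem_support ha).elim
          · exact (hqS _ q.end_mem_support hb).elim
        · rw [h, Sym2.eq_swap]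
        · have : p ∈ s(a, b) := h ▸ Sym2.mem_mk_right _ _
          rcases Sym2.mem_iff.1 this with rfl | rfl
          · exact (hqS _ q.start_mem_support ha).elim
          · exact (hqS _ q.start_mem_support hb).elim
        · exact (hqS _ (q.fst_mem_support_of_mem_edges h) ha).elim
      · intro h
        refine ⟨?_, .inr (.inl (by rw [← h, Sym2.eq_swap]))⟩
        rcases Sym2.eq_iff.1 h with ⟨rfl, rfl⟩ | ⟨rfl, rfl⟩
        · exact ⟨hx, hy, hxy⟩
        · exact ⟨hy, hx, hxy.symm⟩

/-- A shortest ear is a chordless path, and by maximality it exhausts the complement of `S`. It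
plays the role of `T` in the attachment lemmas: its end vertices `x` and `y` are adjacent, and a
third attached vertex would complete a triangle. -/
theorem GraphOrientation.IsCyclic.exists_isCycleGluing_of_maximal {o : GraphOrientation G}
    (ho : o.IsCyclic) (h : TwoLinked G Set.univ) {S : Set V} (hS : TwoLinked G S)
    (hS2 : S.Nontrivial) (hne : S ≠ Set.univ)
    (hmax : ∀ S' : Set V, S ⊆ S' → TwoLinked G S' → S' = S ∨ S' = Set.univ) :
    ∃ C : G.Subgraph, IsCycleGluing G ((⊤ : G.Subgraph).induce S) C := by
  classical
  obtain ⟨x, y, p, p', q, hq, hmin⟩ := exists_minimal_ear h hS2 hne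
  have hmin' : ∀ q' : G.Walk p p', q'.support ⊆ q.support → q.length ≤ q'.length := by
    intro q' hq'
    obtain ⟨h1, h2, h3, h4, h5, h6⟩ := hq
    exact hmin x y p p' q' ⟨h1, h2, h3, h4, h5, fun z hz => h6 z (hq' hz)⟩
  have hp := isPath_of_forall_length_le q hmin'
  have cq := isChordless_of_forall_length_le q hmin'
  obtain ⟨hx, hy, hxy, hxp, hpy, hqS⟩ := id hq
  have huniv : ∀ z, z ∈ S ∨ z ∈ q.support := by
    have hpath : (Walk.cons hxp (q.concat hpy)).IsPath := by
      refine (hp.concat (fun h => hqS y h hy) hpy).cons ?_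
      rw [Walk.support_concat]
      simp only [List.mem_append, List.mem_singleton, not_or]
      exact ⟨fun h => hqS x h hx, hxy⟩
    have hsub := hmax _ Set.subset_union_left (hS.union_support hx hy _ hpath)
    have hpm : p ∈ S ∪ {z | z ∈ (Walk.cons hxp (q.concat hpy)).support} :=
      .inr (by simp [Walk.support_concat])
    rcases hsub with hsub | hsub
    · rw [hsub] at hpm
      exact (hqS p q.start_mem_support hpm).elim
    · intro z
      have hz : z ∈ S ∪ {z | z ∈ (Walk.cons hxp (q.concat hpy)).support} := hsub ▸ trivial
      rcases hz with hz | hz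
      · exact .inl hz
      · simp only [Walk.support_cons, Walk.support_concat, Set.mem_ofPred_eq, List.mem_cons,
          List.mem_append, List.not_mem_nil, or_false] at hz
        rcases hz with rfl | hz | rfl
        · exact .inl hx
        · exact .inr hz
        · exact .inl hy
  -- Otherwise cutting the ear at `t` and ending it in `z` gives a shorter ear; `hstart` is the
  -- mirror image.
  have hend : ∀ z ∈ S, ∀ t ∈ q.support, G.Adj z t → z ≠ x → t = p' := by
    intro z hz t ht hzt hzx
    by_contra hne
    have h1 := hmin x z p t (q.takeUntil t ht) ⟨hx, hz, hzx.symm, hxp, hzt.symm,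
      fun a ha => hqS a (q.support_takeUntil_subset_support ht ha)⟩
    have h2 := Walk.length_takeUntil_lt_length ht hne
    omega
  have hstart : ∀ z ∈ S, ∀ t ∈ q.support, G.Adj z t → z ≠ y → t = p := by
    intro z hz t ht hzt hzy
    by_contra hne
    have h1 := hmin z y t p' (q.dropUntil t ht) ⟨hz, hy, hzy, hzt, hpy,
      fun a ha => hqS a (q.support_dropUntil_subset_support ht ha)⟩
    have h2 := Walk.length_dropUntil_lt_length ht hne
    omega
  have hu : ∀ z ∈ S, ∀ t ∈ {z | z ∈ q.support}, ∀ t' ∈ {z | z ∈ q.support}, G.Adj z t →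
      G.Adj z t' → t = t' := by
    intro z hz t ht t' ht' h1 h2
    by_cases hzx : z = x
    · have hzy : z ≠ y := hzx ▸ hxy
      rw [hstart z hz t ht h1 hzy, hstart z hz t' ht' h2 hzy]
    · rw [hend z hz t ht h1 hzx, hend z hz t' ht' h2 hzx]
  have hS' : ∀ a, LinkedIn G (S \ {a}) := fun a => hS _ Set.subsingleton_singleton
  have hST : ∀ z ∈ S, z ∉ {z | z ∈ q.support} := fun z h1 h2 => hqS z h2 h1
  have hT := linkedIn_support q
  have hadj := ho.adj_of_return hS' hST hT hu hx hy hxy q.start_mem_support q.end_mem_support hxp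
    hpy.symm
  refine isCycleGluing_of_ear q hq hp cq hadj huniv fun z hz t ht hzt => ?_
  by_cases hzx : z = x
  · subst hzx
    exact .inl ⟨rfl, hstart z hz t ht hzt hxy⟩
  by_cases hzy : z = y
  · subst hzy
    exact .inr ⟨rfl, hend z hz t ht hzt hzx⟩
  exact (ho.not_triangle_of_return hST hT hu hx hy hz q.start_mem_support q.end_mem_support ht hxp
    hpy.symm hzt hadj
    (ho.adj_of_return hS' hST hT hu hy hz (Ne.symm hzy) q.end_mem_support ht hpy.symm hzt)
    (ho.adj_of_return hS' hST hT hu hx hz (Ne.symm hzx) q.start_mem_support ht hxp hzt)).elim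

/-- A two-connected graph with a cyclic orientation is a single edge or is glued from a proper
induced subgraph and a cycle. -/
theorem IsTwoConnected.isSingleEdge_or_exists_isCycleGluing [Finite V] (h : IsTwoConnected G)
    (hG : CyclicallyOrientable G) :
    IsSingleEdge G ∨ ∃ G' C : G.Subgraph, IsCycleGluing G G' C := by
  obtain ⟨o, ho⟩ := hG
  have h2 := h.twoLinked
  obtain ⟨e, he⟩ := h.2.1
  induction e using Sym2.ind with | h u v => ?_
  have huv : G.Adj u v := he
  by_cases hpair : ({u, v} : Set V) = Set.univ
  · refine .inl ⟨u, v, huv, ?_⟩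
    have hall : ∀ z : V, z = u ∨ z = v := fun z => by
      have : z ∈ ({u, v} : Set V) := hpair ▸ trivial
      simpa using this
    ext a b
    · simpa using hall a
    · simp only [Subgraph.top_adj, subgraphOfAdj_adj]
      constructor
      · intro hab
        rcases hall a with rfl | rfl <;> rcases hall b with rfl | rfl
        · exact (hab.ne rfl).elim
        · rfl
        · exact Sym2.eq_swap
        · exact (hab.ne rfl).elim
      · intro hab
        rcases Sym2.eq_iff.1 hab with ⟨rfl, rfl⟩ | ⟨rfl, rfl⟩
        · exact huv
        · exact huv.symm
  · right
    -- The two ends of any edge belong to this family, so finiteness provides a maximal member.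
    let F : Set (Set V) := {S | TwoLinked G S ∧ S.Nontrivial ∧ S ≠ Set.univ}
    have hF : F.Nonempty := ⟨{u, v}, twoLinked_pair huv, Set.nontrivial_pair huv.ne, hpair⟩
    obtain ⟨S, hS⟩ := (Set.toFinite F).exists_maximal hF
    obtain ⟨C, hC⟩ := ho.exists_isCycleGluing_of_maximal h2 hS.prop.1 hS.prop.2.1 hS.prop.2.2 (by
      intro S' hSS' hS'
      by_cases hu : S' = Set.univ
      · exact .inr hu
      · exact .inl (Set.Subset.antisymm
          (hS.le_of_ge ⟨hS', hS.prop.2.1.mono hSS', hu⟩ hSS') hSS'))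
    exact ⟨_, C, hC⟩

/-! ### Cyclic orientations of induced subgraphs -/

/-- All edges of the walk point in its direction, or all point in the opposite direction. -/
def IsDirected (arc : V → V → Prop) {u v : V} (c : G.Walk u v) : Prop :=
  (∀ d ∈ c.darts, arc d.fst d.snd) ∨ ∀ d ∈ c.darts, arc d.snd d.fst

/-- `arc` is a cyclic orientation of the subgraph of `G` induced on `S`. -/
structure IsCyclicOn (G : SimpleGraph V) (S : Set V) (arc : V → V → Prop) : Prop where
  mem : ∀ {a b}, arc a b → a ∈ S ∧ b ∈ S ∧ G.Adj a b
  arc_or_arc : ∀ {a b}, a ∈ S → b ∈ S → G.Adj a b → arc a b ∨ arc b a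
  asymm : ∀ {a b}, arc a b → ¬ arc b a
  directed : ∀ (u : V) (c : G.Walk u u), c.IsCycle → c.IsChordless → (∀ z ∈ c.support, z ∈ S) →
    IsDirected arc c

theorem isChordless_map_induce {S : Set V} {u v : S} (c : (G.induce S).Walk u v) :
    (c.map (Embedding.induce S).toHom).IsChordless ↔ c.IsChordless := by
  have hedge : ∀ a b : S, s((a : V), (b : V)) ∈ c.edges.map (Sym2.map (Embedding.induce (G := G) S).toHom) ↔
      s(a, b) ∈ c.edges := by
    intro a b
    exact List.mem_map_of_injective (a := s(a, b)) (Sym2.map.injective Subtype.val_injective)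
  have hmem : ∀ a : S, (a : V) ∈ c.support.map (Embedding.induce (G := G) S).toHom ↔
      a ∈ c.support := fun a => List.mem_map_of_injective Subtype.val_injective
  rw [Walk.isChordless_iff_forall_mem_edges, Walk.isChordless_iff_forall_mem_edges]
  simp only [Walk.support_map, Walk.edges_map]
  constructor
  · intro h a b ha hb hab
    exact (hedge a b).1 (h ((hmem a).2 ha) ((hmem b).2 hb) hab)
  · intro h a b ha hb hab
    obtain ⟨a, ha', rfl⟩ := List.mem_map.1 ha
    obtain ⟨b, hb', rfl⟩ := List.mem_map.1 hb
    exact (hedge a b).2 (h ha' hb' hab)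

theorem isCycle_map_induce {S : Set V} {u : S} (c : (G.induce S).Walk u u) :
    (c.map (Embedding.induce S).toHom).IsCycle ↔ c.IsCycle :=
  Walk.isCycle_map_iff_of_injective Subtype.val_injective

theorem isDirected_map_induce {S : Set V} (arc : V → V → Prop) {u v : S}
    (c : (G.induce S).Walk u v) :
    IsDirected arc (c.map (Embedding.induce S).toHom) ↔ IsDirected (fun a b : S => arc a b) c := by
  unfold IsDirected
  rw [Walk.darts_map]
  simp only [List.forall_mem_map]
  rfl

/-- Chordless cycles of the induced subgraph correspond to chordless cycles of `G` inside `S`. This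
allows working with relations on `V` and walks in `G` instead of subtypes. -/
theorem cyclicallyOrientable_induce_iff (S : Set V) :
    CyclicallyOrientable (G.induce S) ↔ ∃ arc, IsCyclicOn G S arc := by
  constructor
  · rintro ⟨o, ho⟩
    refine ⟨fun a b => ∃ (ha : a ∈ S) (hb : b ∈ S), o.arc ⟨a, ha⟩ ⟨b, hb⟩, ?_, ?_, ?_, ?_⟩
    · rintro a b ⟨ha, hb, h⟩
      exact ⟨ha, hb, o.adj_of_arc h⟩
    · intro a b ha hb hab
      exact (o.arc_or_arc (u := ⟨a, ha⟩) (v := ⟨b, hb⟩) hab).imp (fun h => ⟨ha, hb, h⟩)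
        fun h => ⟨hb, ha, h⟩
    · rintro a b ⟨_, _, h⟩ ⟨_, _, h'⟩
      exact o.asymm h h'
    · intro u c hc cc hcS
      rw [← c.map_induce hcS] at hc cc ⊢
      generalize c.induce S hcS = c' at hc cc ⊢
      refine (isDirected_map_induce _ c').2 ?_
      exact (ho _ c' ((isCycle_map_induce c').1 hc) ((isChordless_map_induce c').1 cc)).imp
        (fun h d hd => ⟨d.fst.2, d.snd.2, h d hd⟩) fun h d hd => ⟨d.snd.2, d.fst.2, h d hd⟩
  · rintro ⟨arc, h⟩
    refine ⟨⟨fun a b => arc a b, fun hab => (h.mem hab).2.2, fun {a b} hab =>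
      h.arc_or_arc a.2 b.2 hab, fun hab => h.asymm hab⟩, ?_⟩
    intro u c hc cc
    have := h.directed _ (c.map (Embedding.induce S).toHom) ((isCycle_map_induce c).2 hc)
      ((isChordless_map_induce c).2 cc) (by
        intro z hz
        rw [Walk.support_map] at hz
        obtain ⟨z, -, rfl⟩ := List.mem_map.1 hz
        exact z.2)
    exact (isDirected_map_induce arc c).1 this

theorem cyclicallyOrientable_coe_iff {B : G.Subgraph} (hB : B.IsInduced) :
    CyclicallyOrientable B.coe ↔ ∃ arc, IsCyclicOn G B.verts arc := by
  have : B.coe = G.induce B.verts := by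
    ext a b
    exact ⟨fun h => B.adj_sub h, fun h => hB a.2 b.2 h⟩
  rw [this]
  exact cyclicallyOrientable_induce_iff _

theorem CyclicallyOrientable.coe (hG : CyclicallyOrientable G) {B : G.Subgraph}
    (hB : B.IsInduced) : CyclicallyOrientable B.coe := by
  obtain ⟨o, ho⟩ := hG
  rw [cyclicallyOrientable_coe_iff hB]
  refine ⟨fun a b => o.arc a b ∧ a ∈ B.verts ∧ b ∈ B.verts,
    fun h => ⟨h.2.1, h.2.2, o.adj_of_arc h.1⟩,
    fun ha hb hab => (o.arc_or_arc hab).imp (fun h => ⟨h, ha, hb⟩) fun h => ⟨h, hb, ha⟩,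
    fun h h' => o.asymm h.1 h'.1, ?_⟩
  intro u c hc cc hcB
  have hfst : ∀ d ∈ c.darts, d.fst ∈ B.verts := fun d hd =>
    hcB _ (c.dart_fst_mem_support_of_mem_darts hd)
  have hsnd : ∀ d ∈ c.darts, d.snd ∈ B.verts := fun d hd =>
    hcB _ (c.dart_snd_mem_support_of_mem_darts hd)
  exact (ho u c hc cc).imp (fun h d hd => ⟨h d hd, hfst d hd, hsnd d hd⟩)
    fun h d hd => ⟨h d hd, hsnd d hd, hfst d hd⟩

/-! ### Directions and inclusions of cycles -/

section Cycles

theorem mem_darts_or_symm_mem_darts {u v : V} {c : G.Walk u v} {d : G.Dart}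
    (h : d.edge ∈ c.edges) : d ∈ c.darts ∨ d.symm ∈ c.darts := by
  obtain ⟨e, he, hde⟩ := List.mem_map.1 h
  rcases SimpleGraph.dart_edge_eq_iff e d |>.1 hde with rfl | rfl
  · exact .inl he
  · exact .inr he

theorem symm_notMem_darts {u v : V} {c : G.Walk u v} (hc : c.IsTrail) {d : G.Dart}
    (h : d ∈ c.darts) : d.symm ∉ c.darts := by
  intro h'
  have := List.inj_on_of_nodup_map hc.edges_nodup h h' d.edge_symm.symm
  exact d.symm_ne this.symm

theorem dart_eq_of_fst_eq {u : V} {c : G.Walk u u} (hc : c.IsCycle) {d e : G.Dart}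
    (hd : d ∈ c.darts) (he : e ∈ c.darts) (h : d.fst = e.fst) : d = e :=
  List.inj_on_of_nodup_map (f := fun d : G.Dart => d.fst)
    (by rw [Walk.map_fst_darts]; exact hc.nodup_dropLast_support) hd he h

theorem dart_eq_of_snd_eq {u : V} {c : G.Walk u u} (hc : c.IsCycle) {d e : G.Dart}
    (hd : d ∈ c.darts) (he : e ∈ c.darts) (h : d.snd = e.snd) : d = e :=
  List.inj_on_of_nodup_map (f := fun d : G.Dart => d.snd)
    (by rw [Walk.map_snd_darts]; exact hc.support_nodup) hd he h

/-- A trail along a cycle runs through it in one of the two directions. -/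
theorem darts_subset_or_symm {u x y : V} {c : G.Walk u u} (hc : c.IsCycle) {p : G.Walk x y}
    (hp : p.IsTrail) (h : ∀ d ∈ p.darts, d.edge ∈ c.edges) :
    (∀ d ∈ p.darts, d ∈ c.darts) ∨ ∀ d ∈ p.darts, d.symm ∈ c.darts := by
  induction p with
  | nil => simp
  | @cons x z y hxz p ih =>
    have hp' := Walk.isTrail_cons hxz p |>.1 hp
    have ih := ih hp'.1 fun d hd => h d (by simp [hd])
    have h0 := mem_darts_or_symm_mem_darts (h ⟨(x, z), hxz⟩ (by simp))
    cases p with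
    | nil => simpa using h0
    | @cons _ t _ hzt p =>
      -- If two consecutive edges ran in opposite senses along `c`, their darts in `c` would share a
      -- start or an end, hence be equal, against the trail property.
      have hne : (⟨(x, z), hxz⟩ : G.Dart).edge ≠ (⟨(z, t), hzt⟩ : G.Dart).edge := by
        intro h
        exact hp'.2 (by
          rw [Walk.edges_cons]
          exact List.mem_cons.2 (.inl h))
      rcases ih with ih | ih
      · left
        have h1 := ih ⟨(z, t), hzt⟩ (by simp)
        have h2 : (⟨(x, z), hxz⟩ : G.Dart) ∈ c.darts := h0.resolve_right fun h2 =>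
          hne (by rw [← dart_eq_of_fst_eq hc h2 h1 rfl, Dart.edge_symm])
        intro d hd
        rw [Walk.darts_cons, List.mem_cons] at hd
        rcases hd with rfl | hd
        · exact h2
        · exact ih d hd
      · right
        have h1 := ih ⟨(z, t), hzt⟩ (by simp)
        have h2 : (⟨(x, z), hxz⟩ : G.Dart).symm ∈ c.darts := h0.resolve_left fun h2 =>
          hne (by rw [dart_eq_of_snd_eq hc h2 h1 rfl, Dart.edge_symm])
        intro d hd
        rw [Walk.darts_cons, List.mem_cons] at hd
        rcases hd with rfl | hd
        · exact h2
        · exact ih d hd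

theorem IsDirected.of_edges_subset {arc : V → V → Prop} {u v : V} {c : G.Walk u u}
    {d : G.Walk v v} (hc : c.IsCycle) (hd : d.IsTrail) (h : d.edges ⊆ c.edges)
    (harc : ∀ e ∈ c.darts, arc e.fst e.snd) : IsDirected arc d := by
  rcases darts_subset_or_symm hc hd fun e he => h (List.mem_map_of_mem he) with h | h
  · exact .inl fun e he => harc e (h e he)
  · exact .inr fun e he => harc e.symm (h e he)

/-- If the neighbours of `b` along the cycle `c` are among those along the cycle `d`, then these
are all. -/
theorem adj_toSubgraph_of_forall {u v b x : V} {c : G.Walk u u} {d : G.Walk v v} (hc : c.IsCycle)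
    (hd : d.IsCycle) (hbc : b ∈ c.support) (hbd : b ∈ d.support)
    (h : ∀ y, s(b, y) ∈ c.edges → s(b, y) ∈ d.edges) (hx : s(b, x) ∈ d.edges) :
    s(b, x) ∈ c.edges := by
  have h1 := hc.ncard_neighborSet_toSubgraph_eq_two hbc
  have h2 := hd.ncard_neighborSet_toSubgraph_eq_two hbd
  have hsub : c.toSubgraph.neighborSet b ⊆ d.toSubgraph.neighborSet b := by
    intro y hy
    rw [Subgraph.mem_neighborSet, Walk.adj_toSubgraph_iff_mem_edges] at hy ⊢
    exact h y hy
  have := Set.eq_of_subset_of_ncard_le hsub (by omega) d.finite_neighborSet_toSubgraph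
  have hx' : x ∈ d.toSubgraph.neighborSet b := by
    rwa [Subgraph.mem_neighborSet, Walk.adj_toSubgraph_iff_mem_edges]
  rw [← this, Subgraph.mem_neighborSet, Walk.adj_toSubgraph_iff_mem_edges] at hx'
  exact hx'

theorem edges_subset_of_isCycle {u v x y : V} {c : G.Walk u u} {d : G.Walk v v} (hc : c.IsCycle)
    (hd : d.IsCycle) (h : c.edges ⊆ d.edges) (p : G.Walk x y) (hp : p.edges ⊆ d.edges)
    (hx : x ∈ c.support) : p.edges ⊆ c.edges := by
  induction p with
  | nil => simp
  | @cons x z y hxz p ih =>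
    have h1 : s(x, z) ∈ d.edges := hp (by simp)
    have h2 := adj_toSubgraph_of_forall hc hd hx (d.fst_mem_support_of_mem_edges h1)
      (fun y hy => h hy) h1
    rw [Walk.edges_cons]
    exact List.cons_subset.2 ⟨h2, ih (fun e he => hp (by simp [he]))
      (c.snd_mem_support_of_mem_edges h2)⟩

/-- Every vertex of `c` has degree two in both cycles, so following `d` from a vertex of `c` never
leaves `c`. -/
theorem edges_subset_of_edges_subset {u v : V} {c : G.Walk u u} {d : G.Walk v v} (hc : c.IsCycle)
    (hd : d.IsCycle) (h : c.edges ⊆ d.edges) : d.edges ⊆ c.edges := by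
  classical
  have hu : u ∈ d.support := by
    cases c with
    | nil => exact (hc.not_nil Walk.Nil.nil).elim
    | @cons _ x _ hux p => exact d.fst_mem_support_of_mem_edges (h (by simp : s(u, x) ∈ _))
  have := edges_subset_of_isCycle hc hd h (d.rotate u hu) (d.rotate_edges u hu).perm.subset
    c.start_mem_support
  exact fun e he => this ((d.rotate_edges u hu).mem_iff.2 he)

theorem not_support_subset_pair {u v w : V} {c : G.Walk u u} (hc : c.IsCycle) :
    ¬ ∀ z ∈ c.support, z = v ∨ z = w := by
  intro h
  have h1 := (List.subperm_of_subset (l₂ := [v, w]) hc.support_nodup (fun z hz => by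
    simpa using h z (List.mem_of_mem_tail hz))).length_le
  have h2 := hc.three_le_length
  simp only [List.length_tail, Walk.length_support, List.length_cons, List.length_nil] at h1
  omega

end Cycles

/-! ### Gluing a cycle along an edge -/

section Gluing

variable {G' C : G.Subgraph}

theorem IsCycleGluing.isInduced (h : IsCycleGluing G G' C) : G'.IsInduced := by
  obtain ⟨-, hsup, v, w, hvw, hinf⟩ := h
  intro a ha b hb hab
  have h1 : (G' ⊔ C).Adj a b := by rw [hsup]; exact hab
  rcases h1 with h1 | h1
  · exact h1
  · have h2 : ∀ z, z ∈ G'.verts → z ∈ C.verts → z = v ∨ z = w := by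
      intro z h1 h2
      have : z ∈ (G' ⊓ C).verts := ⟨h1, h2⟩
      rw [hinf] at this
      simpa using this
    have h3 : (G' ⊓ C).Adj a b := by
      rw [hinf, subgraphOfAdj_adj]
      rcases h2 a ha (C.edge_vert h1) with rfl | rfl <;>
        rcases h2 b hb (C.edge_vert h1.symm) with rfl | rfl
      · exact (hab.ne rfl).elim
      · rfl
      · exact Sym2.eq_swap
      · exact (hab.ne rfl).elim
    exact h3.1

/-- A cycle `d` through the start of a walk along a cycle `c` contains the whole walk, if the
vertices of the walk before its end have no neighbours except along `c`. -/
theorem support_subset_of_isCycle {S : Set V} {u v x y : V} {c : G.Walk u u} {d : G.Walk v v}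
    (hc : c.IsCycle) (hd : d.IsCycle) (hS : ∀ a b, a ∉ S → G.Adj a b → s(a, b) ∈ c.edges)
    (p : G.Walk x y) (hp : p.edges ⊆ c.edges) (hx : x ∈ d.support)
    (hpS : ∀ e ∈ p.darts, e.fst ∉ S) : ∀ z ∈ p.support, z ∈ d.support := by
  induction p with
  | nil => simpa using hx
  | @cons x z y hxz p ih =>
    have hxS : x ∉ S := hpS ⟨(x, z), hxz⟩ (by simp)
    have h1 : s(x, z) ∈ c.edges := hp (by simp)
    have h2 := adj_toSubgraph_of_forall hd hc hx (c.fst_mem_support_of_mem_edges h1)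
      (fun y hy => hS x y hxS (d.adj_of_mem_edges hy)) h1
    have := ih (fun e he => hp (by simp [he])) (d.snd_mem_support_of_mem_edges h2)
      fun e he => hpS e (by simp [he])
    simpa [hx] using this

theorem exists_path_of_mem_darts {u : V} {c : G.Walk u u} (hc : c.IsCycle) {d : G.Dart}
    (hd : d ∈ c.darts) :
    ∃ p : G.Walk d.snd d.fst, p.IsPath ∧ ∀ e, e ∈ c.edges ↔ e = d.edge ∨ e ∈ p.edges := by
  classical
  have hu := c.dart_fst_mem_support_of_mem_darts hd
  have hc' : (c.rotate d.fst hu).IsCycle := by simpa using hc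
  have hd' : d ∈ (c.rotate d.fst hu).darts := (c.rotate_darts d.fst hu).mem_iff.2 hd
  have he : ∀ e, e ∈ c.edges ↔ e ∈ (c.rotate d.fst hu).edges := fun e =>
    (c.rotate_edges d.fst hu).mem_iff.symm
  generalize c.rotate d.fst hu = c' at hc' hd' he
  obtain ⟨⟨x, y⟩, hxy⟩ := d
  simp only at c' hc' hd' he ⊢
  cases c' with
  | nil => simp at hd'
  | @cons _ z _ hxz p =>
    have := dart_eq_of_fst_eq hc' hd' (e := ⟨(x, z), hxz⟩) (by simp) rfl
    have hyz : y = z := congrArg (fun d : G.Dart => d.snd) this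
    subst hyz
    exact ⟨p, ((Walk.cons_isCycle_iff p hxz).1 hc').1, fun e => by rw [he]; simp [Dart.edge]⟩

theorem exists_path_of_mem_edges {u x y : V} {c : G.Walk u u} (hc : c.IsCycle)
    (h : s(x, y) ∈ c.edges) :
    ∃ p : G.Walk y x, p.IsPath ∧ ∀ e, e ∈ c.edges ↔ e = s(x, y) ∨ e ∈ p.edges := by
  rcases mem_darts_or_symm_mem_darts (d := ⟨(x, y), c.adj_of_mem_edges h⟩) h with h | h
  · exact exists_path_of_mem_darts hc h
  · obtain ⟨p, hp, hpe⟩ : ∃ p : G.Walk x y, p.IsPath ∧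
        ∀ e, e ∈ c.edges ↔ e = s(y, x) ∨ e ∈ p.edges := exists_path_of_mem_darts hc h
    exact ⟨p.reverse, hp.reverse, fun e => by
      rw [hpe, Walk.edges_reverse, List.mem_reverse, Sym2.eq_swap]⟩

theorem fst_ne_of_isPath {u v : V} {p : G.Walk u v} (hp : p.IsPath) {d : G.Dart}
    (hd : d ∈ p.darts) : d.fst ≠ v := by
  have h := hp.support_nodup
  rw [← Walk.map_fst_darts_append, List.nodup_append'] at h
  intro h'
  exact h.2.2 (List.mem_map_of_mem hd) (by simp [h'])

/-- From `b` the cycle `d` is forced along `c` both ways until it reaches `x` and `y`. It thus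
contains all vertices of `c` and, being chordless, all edges of `c`; nested cycles are equal. -/
theorem edges_subset_of_notMem {S : Set V} {u v x y b : V} {c : G.Walk u u} {d : G.Walk v v}
    (hc : c.IsCycle) (hd : d.IsCycle) (cd : d.IsChordless)
    (hS : ∀ a b, a ∉ S → G.Adj a b → s(a, b) ∈ c.edges)
    (hcS : ∀ z ∈ c.support, z ∈ S → z = x ∨ z = y) (hx : x ∈ S) (hy : y ∈ S)
    (hxy : s(x, y) ∈ c.edges)
    (hb : b ∈ d.support) (hbS : b ∉ S) : d.edges ⊆ c.edges := by
  classical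
  obtain ⟨p, hp, hpc⟩ := exists_path_of_mem_edges hc hxy
  have hpc' : p.edges ⊆ c.edges := fun e he => (hpc e).2 (.inr he)
  have hbp : b ∈ p.support := by
    have := hd.ncard_neighborSet_toSubgraph_eq_two hb
    obtain ⟨z, hz⟩ := Set.nonempty_of_ncard_ne_zero (by omega :
      (d.toSubgraph.neighborSet b).ncard ≠ 0)
    rcases (hpc _).1 (hS b z hbS (d.toSubgraph.adj_sub hz)) with h | h
    · have : b ∈ s(x, y) := h ▸ Sym2.mem_mk_left _ _
      rcases Sym2.mem_iff.1 this with rfl | rfl <;> contradiction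
    · exact p.fst_mem_support_of_mem_edges h
  have harc : ∀ (s t : V) (r : G.Walk b s), (∀ z ∈ c.support, z ∈ S → z = s ∨ z = t) → r.IsPath →
      r.edges ⊆ c.edges → t ∉ r.support → ∀ z ∈ r.support, z ∈ d.support := by
    intro s t r hst hr hrc ht
    refine support_subset_of_isCycle hc hd hS r hrc hb fun e he heS => ?_
    have h1 : e.fst ∈ c.support := c.fst_mem_support_of_mem_edges (hrc (List.mem_map_of_mem he))
    rcases hst _ h1 heS with h | h
    · exact fst_ne_of_isPath hr he h
    · exact ht (h ▸ r.dart_fst_mem_support_of_mem_darts he)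
  have hspec := hp
  rw [← p.take_spec hbp] at hspec
  have hpd : ∀ z ∈ p.support, z ∈ d.support := by
    intro z hz
    rw [← p.take_spec hbp, Walk.mem_support_append_iff] at hz
    rcases hz with hz | hz
    · refine harc y x (p.takeUntil b hbp).reverse (fun z h1 h2 => (hcS z h1 h2).symm)
        (hp.takeUntil hbp).reverse ?_ ?_ z (by simpa using hz)
      · rw [Walk.edges_reverse]
        exact fun e he => hpc' (p.edges_takeUntil_subset_edges hbp (List.mem_reverse.1 he))
      · rw [Walk.support_reverse, List.mem_reverse]
        exact fun h => hspec.ne_of_mem_support_of_append (fun h => hbS (h ▸ hx)) h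
          (Walk.end_mem_support _) rfl
    · refine harc x y (p.dropUntil b hbp) hcS (hp.dropUntil hbp)
        (fun e he => hpc' (p.edges_dropUntil_subset_edges hbp he)) ?_ z hz
      exact fun h => hspec.ne_of_mem_support_of_append (fun h => hbS (h ▸ hy))
        (Walk.start_mem_support _) h rfl
  refine edges_subset_of_edges_subset hc hd fun e he => ?_
  induction e using Sym2.ind with | h a b => ?_
  have hadj := c.adj_of_mem_edges he
  rcases (hpc _).1 he with h | h
  · rw [h]
    rw [← mem_edgeSet, h] at hadj
    exact cd.mem_edges (hpd x p.end_mem_support) (hpd y p.start_mem_support) hadj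
  · exact cd.mem_edges (hpd a (p.fst_mem_support_of_mem_edges h))
      (hpd b (p.snd_mem_support_of_mem_edges h)) hadj

/-- A cyclic orientation of an induced subgraph extends to a cycle glued along an edge. -/
theorem IsCyclicOn.cyclicallyOrientable {S : Set V} {arc : V → V → Prop} (h : IsCyclicOn G S arc)
    {u v w : V} {c : G.Walk u u} (hc : c.IsCycle) (hvw : arc v w) (hd : s(v, w) ∈ c.edges)
    (hS : ∀ a b, a ∉ S → G.Adj a b → s(a, b) ∈ c.edges)
    (hcS : ∀ z ∈ c.support, z ∈ S → z = v ∨ z = w) : CyclicallyOrientable G := by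
  obtain ⟨hv, hw, hadj⟩ := h.mem hvw
  -- The cycle is traversed so that it agrees with the given arc from `v` to `w`.
  obtain ⟨c', hc', hd', he⟩ : ∃ c' : G.Walk u u, c'.IsCycle ∧ (⟨(v, w), hadj⟩ : G.Dart) ∈ c'.darts ∧
      ∀ e, e ∈ c'.edges ↔ e ∈ c.edges := by
    rcases mem_darts_or_symm_mem_darts (d := ⟨(v, w), hadj⟩) hd with h | h
    · exact ⟨c, hc, h, fun e => Iff.rfl⟩
    · exact ⟨c.reverse, hc.reverse, by
        rw [Walk.darts_reverse, List.mem_reverse]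
        exact List.mem_map.2 ⟨_, h, Dart.symm_symm _⟩, fun e => by simp⟩
  have hcS' : ∀ e : G.Dart, e ∈ c'.darts → e.fst ∈ S → e.snd ∈ S → e = ⟨(v, w), hadj⟩ := by
    intro e h1 h2 h3
    have h4 : s(e.fst, e.snd) ∈ c.edges := (he _).1 (List.mem_map_of_mem h1)
    have h5 := hcS _ (c.fst_mem_support_of_mem_edges h4) h2
    have h6 := hcS _ (c.snd_mem_support_of_mem_edges h4) h3
    rcases h5 with h5 | h5
    · exact dart_eq_of_fst_eq hc' h1 hd' h5
    · rcases h6 with h6 | h6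
      · have : e = (⟨(v, w), hadj⟩ : G.Dart).symm := Dart.ext _ _ (Prod.ext h5 h6)
        exact (symm_notMem_darts hc'.isTrail hd' (this ▸ h1)).elim
      · exact (e.adj.ne (h5.trans h6.symm)).elim
  refine ⟨⟨fun a b => arc a b ∨ ∃ hab : G.Adj a b, (⟨(a, b), hab⟩ : G.Dart) ∈ c'.darts, ?_, ?_, ?_⟩,
    ?_⟩
  · rintro a b (h1 | ⟨hab, -⟩)
    · exact (h.mem h1).2.2
    · exact hab
  · intro a b hab
    by_cases hs : a ∈ S ∧ b ∈ S
    · exact (h.arc_or_arc hs.1 hs.2 hab).imp .inl .inl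
    · have h1 : s(a, b) ∈ c'.edges := by
        rw [he]
        by_cases ha : a ∈ S
        · rw [Sym2.eq_swap]
          exact hS b a (fun hb => hs ⟨ha, hb⟩) hab.symm
        · exact hS a b ha hab
      exact (mem_darts_or_symm_mem_darts (d := ⟨(a, b), hab⟩) h1).imp (fun h => .inr ⟨hab, h⟩)
        fun h => .inr ⟨hab.symm, h⟩
  -- The old arcs and the darts of `c'` overlap only on the edge `vw`, where they agree.
  · have key : ∀ {a b} (hab : G.Adj b a), arc a b → (⟨(b, a), hab⟩ : G.Dart) ∉ c'.darts := by
      intro a b hab h1 h2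
      have h3 := h.mem h1
      have h4 := hcS' _ h2 h3.2.1 h3.1
      have hb : b = v := congrArg (fun d : G.Dart => d.fst) h4
      have ha : a = w := congrArg (fun d : G.Dart => d.snd) h4
      subst hb ha
      exact h.asymm h1 hvw
    rintro a b (h1 | ⟨hab, h1⟩) (h2 | ⟨hab', h2⟩)
    · exact h.asymm h1 h2
    · exact key hab' h1 h2
    · exact key hab h2 h1
    · exact symm_notMem_darts hc'.isTrail h1 h2
  · intro z d hd cd
    by_cases hdS : ∀ b ∈ d.support, b ∈ S
    · exact (h.directed z d hd cd hdS).imp (fun h e he => .inl (h e he)) fun h e he => .inl (h e he)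
    · push Not at hdS
      obtain ⟨b, hb, hbS⟩ := hdS
      have := edges_subset_of_notMem hc hd cd hS hcS hv hw ‹s(v, w) ∈ c.edges› hb hbS
      exact IsDirected.of_edges_subset hc' hd.isTrail (fun e h => (he e).2 (this h))
        fun e he => .inr ⟨e.adj, he⟩

theorem IsCycleGluing.cyclicallyOrientable_iff (h : IsCycleGluing G G' C) :
    CyclicallyOrientable G ↔ CyclicallyOrientable G'.coe := by
  have hind := h.isInduced
  refine ⟨fun hG => hG.coe hind, fun hG => ?_⟩
  obtain ⟨arc, harc⟩ := (cyclicallyOrientable_coe_iff hind).1 hG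
  obtain ⟨⟨u, c, hc, rfl⟩, hsup, v, w, hvw, hinf⟩ := h
  have hadj : (G' ⊓ c.toSubgraph).Adj v w := by rw [hinf]; rfl
  have hed : s(v, w) ∈ c.edges := Walk.adj_toSubgraph_iff_mem_edges.1 hadj.2
  have hS : ∀ a b, a ∉ G'.verts → G.Adj a b → s(a, b) ∈ c.edges := by
    intro a b ha hab
    have h1 : (G' ⊔ c.toSubgraph).Adj a b := by rw [hsup]; exact hab
    rcases h1 with h1 | h1
    · exact (ha (G'.edge_vert h1)).elim
    · exact Walk.adj_toSubgraph_iff_mem_edges.1 h1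
  have hcS : ∀ z ∈ c.support, z ∈ G'.verts → z = v ∨ z = w := by
    intro z h1 h2
    have : z ∈ (G' ⊓ c.toSubgraph).verts := ⟨h2, (c.mem_verts_toSubgraph).2 h1⟩
    rw [hinf] at this
    simpa using this
  rcases harc.arc_or_arc (G'.edge_vert hadj.1) (G'.edge_vert hadj.1.symm) hvw with h1 | h1
  · exact harc.cyclicallyOrientable hc h1 hed hS hcS
  · exact harc.cyclicallyOrientable hc h1 (Sym2.eq_swap ▸ hed) hS fun z hz hzS => (hcS z hz hzS).symm

end Gluing

/-! ### Single edges and cycles -/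

theorem isCyclicOn_pair {v w : V} (hvw : G.Adj v w) :
    IsCyclicOn G {v, w} fun a b => a = v ∧ b = w where
  mem := by
    rintro a b ⟨rfl, rfl⟩
    exact ⟨.inl rfl, .inr rfl, hvw⟩
  arc_or_arc := by
    rintro a b (rfl | rfl) (rfl | rfl) hab
    · exact (hab.ne rfl).elim
    · exact .inl ⟨rfl, rfl⟩
    · exact .inr ⟨rfl, rfl⟩
    · exact (hab.ne rfl).elim
  asymm := by
    rintro a b ⟨rfl, rfl⟩ ⟨h, -⟩
    exact hvw.ne h.symm
  directed u c hc _ h := (not_support_subset_pair hc h).elim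

theorem IsCycleGraph.cyclicallyOrientable (h : IsCycleGraph G) : CyclicallyOrientable G := by
  obtain ⟨u, c, hc, hctop⟩ := h
  have hed : ∀ a b, G.Adj a b → s(a, b) ∈ c.edges := by
    intro a b hab
    rw [← Walk.adj_toSubgraph_iff_mem_edges, hctop]
    exact hab
  have huv := c.adj_snd hc.not_nil
  -- The cycle is regarded as glued to its own first edge.
  exact (isCyclicOn_pair huv).cyclicallyOrientable hc ⟨rfl, rfl⟩ (hed _ _ huv)
    (fun a b _ hab => hed a b hab) fun z _ hz => hz

theorem IsSingleEdge.cyclicallyOrientable (h : IsSingleEdge G) : CyclicallyOrientable G := by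
  obtain ⟨v, w, hvw, htop⟩ := h
  have hall : ∀ z : V, z = v ∨ z = w := fun z => by
    have : z ∈ (⊤ : G.Subgraph).verts := trivial
    rw [htop] at this
    simpa using this
  have h := isCyclicOn_pair hvw
  exact ⟨⟨fun a b => a = v ∧ b = w, fun hab => (h.mem hab).2.2,
    fun hab => h.arc_or_arc (hall _) (hall _) hab, h.asymm⟩,
    fun u c hc cc => h.directed u c hc cc fun z _ => hall z⟩

/-! ### Edge equivalence and two-connected components -/

/-- The paths close up to a cycle unless both have length one; then they are the same edge, and the
relation holds by equality. -/
theorem edgeRel_of_paths {a b : V} {R : G.Walk a b} {Q : G.Walk b a} (hR : R.IsPath)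
    (hQ : Q.IsPath) (hab : a ≠ b) (h : ∀ z ∈ R.support, z ∈ Q.support → z = a ∨ z = b)
    {e g : Sym2 V} (he : e ∈ R.edges) (hg : g ∈ Q.edges) : EdgeRel G e g := by
  by_cases hlen : 1 < R.length ∨ 1 < Q.length
  · refine .inr ⟨a, R.append Q, hR.isCycle_append hQ ?_ hlen, by simp [he], by simp [hg]⟩
    intro z h1 h2
    have h3 := hR.support_nodup
    have h4 := hQ.support_nodup
    rw [← Walk.cons_tail_support, List.nodup_cons] at h3 h4
    rcases h z (List.mem_of_mem_tail h1) (List.mem_of_mem_tail h2) with rfl | rfl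
    · exact h3.1 h1
    · exact h4.1 h2
  · push Not at hlen
    left
    have key : ∀ {x y : V} (W : G.Walk x y) {f : Sym2 V}, W.length ≤ 1 → f ∈ W.edges →
        f = s(x, y) := by
      intro x y W f hW hf
      cases W with
      | nil => simp at hf
      | cons hxz W =>
        cases W with
        | nil => simpa using hf
        | cons hzt W => simp at hW
    rw [key R hlen.1 he, key Q hlen.2 hg, Sym2.eq_swap]

/-- An edge of a cycle is related to every edge of a path joining two vertices of the cycle. -/
theorem edgeRel_of_ear {u x y : V} {c : G.Walk u u} (hc : c.IsCycle) (hxy : x ≠ y)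
    (hx : x ∈ c.support) (hy : y ∈ c.support) {P : G.Walk x y} (hP : P.IsPath)
    (h : ∀ z ∈ P.support, z ∈ c.support → z = x ∨ z = y) {e g : Sym2 V} (he : e ∈ c.edges)
    (hg : g ∈ P.edges) : EdgeRel G e g := by
  classical
  have hc' : (c.rotate x hx).IsCycle := by simpa using hc
  have he' : e ∈ (c.rotate x hx).edges := (c.rotate_edges x hx).mem_iff.2 he
  have hs : ∀ z, z ∈ (c.rotate x hx).support ↔ z ∈ c.support := by simp
  generalize c.rotate x hx = d at hc' he' hs
  have hyd := (hs y).2 hy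
  have hT := hc'.isPath_takeUntil hyd
  have hD : (d.dropUntil y hyd).IsPath := Walk.IsCycle.isPath_of_append_right
    (p := d.takeUntil y hyd) (by rwa [Walk.nil_takeUntil]) (by rwa [d.take_spec])
  rw [← d.take_spec hyd, Walk.edges_append, List.mem_append] at he'
  rcases he' with he' | he'
  · exact edgeRel_of_paths hT hP.reverse hxy (fun z h1 h2 => h z (by simpa using h2)
      ((hs z).1 (d.support_takeUntil_subset_support hyd h1))) he' (by simpa using hg)
  · exact edgeRel_of_paths hD hP hxy.symm (fun z h1 h2 => (h z h2
      ((hs z).1 (d.support_dropUntil_subset_support hyd h1))).symm) he' hg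

/-- Every edge of a path with ends in `S` lies on a subpath that meets `S` in its ends only. -/
theorem exists_path_through_edge [DecidableEq V] (S : Finset V) {g : Sym2 V} (n : ℕ) {a b : V}
    (p : G.Walk a b)
    (hn : p.length ≤ n) (hp : p.IsPath) (ha : a ∈ S) (hb : b ∈ S) (hg : g ∈ p.edges) :
    ∃ (x y : V) (P : G.Walk x y), x ≠ y ∧ x ∈ S ∧ y ∈ S ∧ P.IsPath ∧ g ∈ P.edges ∧
      ∀ z ∈ P.support, z ∈ S → z = x ∨ z = y := by
  induction n generalizing a with
  | zero =>
    cases p with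
    | nil => simp at hg
    | cons h p => simp at hn
  | succ n ih =>
    cases p with
    | nil => simp at hg
    | @cons _ z _ haz p =>
      have hap := (Walk.cons_isPath_iff haz p).1 hp
      -- `y` is the first return to `S`; if `g` is not passed by then, the search restarts at `y`.
      obtain ⟨y, hyS, hyp, hy⟩ := p.exists_mem_support_forall_mem_support_imp_eq S
        ⟨b, by simp [hb]⟩
      by_cases hgt : g ∈ (Walk.cons haz (p.takeUntil y hyp)).edges
      · refine ⟨a, y, Walk.cons haz (p.takeUntil y hyp), fun h => hap.2 (h ▸ hyp), ha, hyS,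
          (hap.1.takeUntil hyp).cons
            fun h => hap.2 (p.support_takeUntil_subset_support hyp h), hgt, ?_⟩
        intro t ht htS
        rw [Walk.support_cons, List.mem_cons] at ht
        exact ht.imp id fun ht => hy t htS ht
      · refine ih (p.dropUntil y hyp) ?_ (hap.1.dropUntil hyp) hyS ?_
        · have := p.length_dropUntil_le_length hyp
          rw [Walk.length_cons] at hn
          omega
        · rw [Walk.edges_cons, ← p.take_spec hyp, Walk.edges_append] at hg
          rw [Walk.edges_cons] at hgt
          simp only [List.mem_cons, List.mem_append] at hg hgt
          tauto

theorem EdgeRel.symm {e f : Sym2 V} (h : EdgeRel G e f) : EdgeRel G f e := by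
  rcases h with rfl | ⟨u, c, hc, he, hf⟩
  · exact .inl rfl
  · exact .inr ⟨u, c, hc, hf, he⟩

/-- Removing `f` from the second cycle leaves a path between two vertices of the first. If `g` is
not on the first cycle, the segment of this path around `g` is an ear of that cycle, and
`edgeRel_of_ear` applies. -/
theorem EdgeRel.trans {e f g : Sym2 V} (h : EdgeRel G e f) (h' : EdgeRel G f g) :
    EdgeRel G e g := by
  classical
  rcases h with rfl | ⟨u, c, hc, he, hf⟩
  · exact h'
  rcases h' with rfl | ⟨v, d, hd, hfd, hg⟩
  · exact .inr ⟨u, c, hc, he, hf⟩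
  by_cases hgc : g ∈ c.edges
  · exact .inr ⟨u, c, hc, he, hgc⟩
  induction f using Sym2.ind with | h a b => ?_
  obtain ⟨p, hp, hpd⟩ := exists_path_of_mem_edges hd hfd
  have hgp : g ∈ p.edges := ((hpd g).1 hg).resolve_left fun h => hgc (h ▸ hf)
  obtain ⟨x, y, P, hxy, hx, hy, hP, hgP, hPc⟩ := exists_path_through_edge c.support.toFinset _ p
    le_rfl hp (List.mem_toFinset.2 (c.snd_mem_support_of_mem_edges hf))
    (List.mem_toFinset.2 (c.fst_mem_support_of_mem_edges hf)) hgp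
  simp only [List.mem_toFinset] at hx hy hPc
  exact edgeRel_of_ear hc hxy hx hy hP hPc he hgP

/-- An edge joining ends of two related edges is related to them. -/
theorem EdgeRel.of_adj {f g : Sym2 V} {a b : V} (h : EdgeRel G f g) (ha : a ∈ f) (hb : b ∈ g)
    (hab : G.Adj a b) : EdgeRel G f s(a, b) := by
  rcases h with rfl | ⟨u, c, hc, hf, hg⟩
  · exact .inl ((Sym2.mem_and_mem_iff hab.ne).1 ⟨ha, hb⟩)
  · refine edgeRel_of_ear hc hab.ne (c.mem_support_of_mem_edges hf ha)
      (c.mem_support_of_mem_edges hg hb) hab.isPath_toWalk (fun z hz _ => ?_) hf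
      (by simp [SimpleGraph.Adj.toWalk])
    rw [hab.support_toWalk] at hz
    simpa using hz

/-- The subgraph formed by the edges related to `e` and their endpoints. -/
def edgeClassSubgraph (G : SimpleGraph V) (e : Sym2 V) : G.Subgraph where
  verts := {x | ∃ f ∈ G.edgeSet, EdgeRel G e f ∧ x ∈ f}
  Adj a b := G.Adj a b ∧ EdgeRel G e s(a, b)
  adj_sub h := h.1
  edge_vert {a b} h := ⟨s(a, b), h.1, h.2, Sym2.mem_mk_left a b⟩
  symm := ⟨fun _ _ h => ⟨h.1.symm, by rw [Sym2.eq_swap]; exact h.2⟩⟩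

theorem edgeClassSubgraph_eq {e f : Sym2 V} (h : EdgeRel G e f) :
    edgeClassSubgraph G e = edgeClassSubgraph G f := by
  have key : ∀ g, EdgeRel G e g ↔ EdgeRel G f g := fun g => ⟨h.symm.trans, h.trans⟩
  ext a b
  · simp only [edgeClassSubgraph, key]
  · simp only [edgeClassSubgraph, key]

theorem toSubgraph_le_of_forall_edges {H : G.Subgraph} {u v : V} (p : G.Walk u v) (hu : u ∈ H.verts)
    (h : ∀ e ∈ p.edges, e ∈ H.edgeSet) : p.toSubgraph ≤ H := by
  induction p with
  | nil => simpa [Walk.toSubgraph] using hu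
  | cons huv p ih =>
    have h1 := h _ (by rw [Walk.edges_cons]; exact List.mem_cons_self)
    rw [Subgraph.mem_edgeSet] at h1
    exact sup_le (subgraphOfAdj_le_of_adj H h1)
      (ih (H.edge_vert h1.symm) fun e he => h e (by simp [he]))

theorem isTwoConnectedComponent_edgeClassSubgraph {e : Sym2 V} (he : e ∈ G.edgeSet) :
    IsTwoConnectedComponent G (edgeClassSubgraph G e) := by
  classical
  refine ⟨?_, ?_, e, he, ?_⟩
  · induction e using Sym2.ind with | h a b => ?_
    have hwalk : ∀ x ∈ (edgeClassSubgraph G s(a, b)).verts, ∃ p : G.Walk a x,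
        p.toSubgraph ≤ edgeClassSubgraph G s(a, b) := by
      rintro x ⟨f, hf, hef, hxf⟩
      have ha : a ∈ (edgeClassSubgraph G s(a, b)).verts := ⟨_, he, .inl rfl, Sym2.mem_mk_left a b⟩
      rcases hef with rfl | ⟨u, c, hc, hec, hfc⟩
      · rcases Sym2.mem_iff.1 hxf with rfl | rfl
        · exact ⟨Walk.nil, toSubgraph_le_of_forall_edges _ ha (by simp)⟩
        · have hax : G.Adj a x := he
          refine ⟨Walk.cons hax Walk.nil, toSubgraph_le_of_forall_edges _ ha fun g hg => ?_⟩
          simp only [Walk.edges_cons, Walk.edges_nil, List.mem_singleton] at hg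
          subst hg
          exact ⟨he, .inl rfl⟩
      · have hac := c.fst_mem_support_of_mem_edges hec
        have hxc := c.mem_support_of_mem_edges hfc hxf
        have hxr : x ∈ (c.rotate a hac).support := by simpa using hxc
        refine ⟨(c.rotate a hac).takeUntil x hxr, toSubgraph_le_of_forall_edges _ ha fun g hg => ?_⟩
        have hgc : g ∈ c.edges := (c.rotate_edges a hac).mem_iff.1
          ((c.rotate a hac).edges_takeUntil_subset_edges hxr hg)
        induction g using Sym2.ind with | h y z => ?_
        exact ⟨c.adj_of_mem_edges hgc, .inr ⟨u, c, hc, hec, hgc⟩⟩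
    rw [Subgraph.connected_iff, Subgraph.preconnected_iff_forall_exists_walk_subgraph]
    refine ⟨fun {x y} hx hy => ?_, a, _, he, .inl rfl, Sym2.mem_mk_left a b⟩
    obtain ⟨p, hp⟩ := hwalk x hx
    obtain ⟨q, hq⟩ := hwalk y hy
    refine ⟨p.reverse.append q, ?_⟩
    rw [Walk.toSubgraph_append, Walk.toSubgraph_reverse]
    exact sup_le hp hq
  · rintro a ⟨f, hf, hef, haf⟩ b ⟨g, hg, heg, hbg⟩ hab
    exact ⟨hab, hef.trans ((hef.symm.trans heg).of_adj haf hbg hab)⟩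
  · ext f
    induction f using Sym2.ind with | h a b => rfl

/-- Each edge takes its direction from the orientation chosen for its own component. All edges of a
cycle are equivalent, so only one component's choice is involved. -/
theorem cyclicallyOrientable_of_components
    (h : ∀ B : G.Subgraph, IsTwoConnectedComponent G B → CyclicallyOrientable B.coe) :
    CyclicallyOrientable G := by
  have h' : ∀ B : G.Subgraph, IsTwoConnectedComponent G B → ∃ arc, IsCyclicOn G B.verts arc :=
    fun B hB => (cyclicallyOrientable_coe_iff hB.2.1).1 (h B hB)
  choose! F hF using h'
  have hcomp : ∀ {a b}, G.Adj a b → IsCyclicOn G (edgeClassSubgraph G s(a, b)).verts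
      (F (edgeClassSubgraph G s(a, b))) :=
    fun {a b} hab => hF _ (isTwoConnectedComponent_edgeClassSubgraph (e := s(a, b)) hab)
  refine ⟨⟨fun a b => G.Adj a b ∧ F (edgeClassSubgraph G s(a, b)) a b, fun h => h.1, ?_, ?_⟩, ?_⟩
  · intro a b hab
    -- Both directions of an edge must refer to the same component.
    rw [Sym2.eq_swap (a := b)]
    exact ((hcomp hab).arc_or_arc ⟨s(a, b), hab, .inl rfl, Sym2.mem_mk_left a b⟩
      ⟨s(a, b), hab, .inl rfl, Sym2.mem_mk_right a b⟩ hab).imp (fun h => ⟨hab, h⟩)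
      fun h => ⟨hab.symm, h⟩
  · rintro a b ⟨hab, h1⟩ ⟨-, h2⟩
    rw [Sym2.eq_swap] at h2
    exact (hcomp hab).asymm h1 h2
  · intro u c hc cc
    have hadj := c.adj_snd hc.not_nil
    have he : s(u, c.snd) ∈ c.edges :=
      Walk.adj_toSubgraph_iff_mem_edges.1 (c.toSubgraph_adj_snd hc.not_nil)
    have hrel : ∀ f ∈ c.edges, EdgeRel G s(u, c.snd) f := fun f hf => .inr ⟨u, c, hc, he, hf⟩
    have hsupp : ∀ z ∈ c.support, z ∈ (edgeClassSubgraph G s(u, c.snd)).verts := by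
      intro z hz
      rcases Walk.mem_support_iff_exists_mem_edges.1 hz with rfl | ⟨f, hf, hzf⟩
      · exact ⟨_, hadj, .inl rfl, Sym2.mem_mk_left _ _⟩
      · exact ⟨f, c.edges_subset_edgeSet hf, hrel f hf, hzf⟩
    have hd : ∀ d ∈ c.darts, edgeClassSubgraph G s(d.fst, d.snd) =
        edgeClassSubgraph G s(u, c.snd) := fun d hd =>
      (edgeClassSubgraph_eq (hrel _ (List.mem_map_of_mem hd))).symm
    refine ((hcomp hadj).directed u c hc cc hsupp).imp (fun h d hdc => ⟨d.adj, ?_⟩)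
      fun h d hdc => ⟨d.adj.symm, ?_⟩
    · rw [hd d hdc]
      exact h d hdc
    · rw [Sym2.eq_swap, hd d hdc]
      exact h d hdc

end CyclicOrientation

theorem theorem1 {V : Type*} [Finite V] (G : SimpleGraph V) :
    (CyclicOrientation.CyclicallyOrientable G ↔
      ∀ B : G.Subgraph, CyclicOrientation.IsTwoConnectedComponent G B →
        CyclicOrientation.CyclicallyOrientable B.coe) ∧
    (CyclicOrientation.IsTwoConnected G →
      (CyclicOrientation.CyclicallyOrientable G ↔
        CyclicOrientation.IsCycleGraph G ∨ CyclicOrientation.IsSingleEdge G ∨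
          ∃ G' C : G.Subgraph, CyclicOrientation.IsCycleGluing G G' C ∧
            CyclicOrientation.CyclicallyOrientable G'.coe)) ∧
    (∀ G' C : G.Subgraph, CyclicOrientation.IsCycleGluing G G' C →
      (CyclicOrientation.CyclicallyOrientable G ↔
        CyclicOrientation.CyclicallyOrientable G'.coe)) := by
  refine ⟨⟨fun hG B hB => hG.coe hB.2.1, CyclicOrientation.cyclicallyOrientable_of_components⟩,
    fun h2 => ⟨fun hG => .inr ?_, ?_⟩, fun G' C h => h.cyclicallyOrientable_iff⟩
  · rcases h2.isSingleEdge_or_exists_isCycleGluing hG with h | ⟨G', C, h⟩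
    · exact .inl h
    · exact .inr ⟨G', C, h, h.cyclicallyOrientable_iff.1 hG⟩
  · rintro (h | h | ⟨G', C, h, hG'⟩)
    · exact h.cyclicallyOrientable
    · exact h.cyclicallyOrientable
    · exact h.cyclicallyOrientable_iff.2 hG'
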